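/- Let $G$ be a path connected, locally compact, second countable Hausdorff group and let $\Gamma\le G$ be a discrete subgroup. Let $\mu_{G/\Gamma}$ be a nonzero Radon measure on $G/\Gamma$ that is relatively invariant under left translation: for every $g\in G$ there is a constant $c(g)$ with $g_*\mu_{G/\Gamma}=c(g)\,\mu_{G/\Gamma}$. (Such measures always exist, and if $G$ is unimodular, then $\mu_{G/\Gamma}$ may be taken to be $G$-invariant.) Let $\kappa$ be the Koopman representation of $G$ on $L^2(G/\Gamma,\mu_{G/\Gamma})$, $(\kappa(g)f)(x)=f(g^{-1}x)\big(\tfrac{dg_*\mu_{G/\Gamma}}{d\mu_{G/\Gamma}}(x)\big)^{1/2}$. For a subgroup $H\le G$ we say that $L^2(G/\Gamma,\mu_{G/\Gamma})$ admits $H$-almost invariant vectors if for every compact $Q\subseteq H$ and every $\varepsilon>0$ there is $f\ne 0$ with $\|\kappa(h)f-f\|<\varepsilon\|f\|$ for all $h\in Q$. Assume that $\Gamma$ is not coamenable, that is, $L^2(G/\Gamma,\mu_{G/\Gamma})$ does not admit $G$-almost invariant vectors. Assume that one of the following holds: 1. $G$ has Kazhdan's property (T). 2. $G=\langle G_n\rangle_{n\in\mathbf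 N}$ is generated by a sequence of subgroups such that (a) $G_n$ commutes with $G_{n+1}$ for every $n$, (b) $L^2(G/\Gamma,\mu_{G/\Gamma})$ has no nonzero $\kappa(G_n)$-invariant vectors for every $n$, and (c) for some $i$, $L^2(G/\Gamma,\mu_{G/\Gamma})$ does not admit $G_i$-almost invariant vectors. Then $G/\Gamma$ has exactly one infinite volume end with respect to $\mu_{G/\Gamma}$: for every compact $K\subseteq G/\Gamma$, exactly one connected component of $(G/\Gamma)\setminus K$ has infinite $\mu_{G/\Gamma}$-measure. Moreover, if $G$ is unimodular and the injectivity radius of $G/\Gamma$ is bounded away from $0$ (there is a relatively compact neighbourhood $U$ of the identity in $G$ such that for every $x\in G/\Gamma$ the map $g\mapsto gx$ is injective on $U$), then $G/\Gamma$ has exactly one topological end: for every increasing sequence of compact sets $K_n$ whose interiors cover $G/\Gamma$, there is exactly one decreasing sequence of open sets $U_n$ with $U_n$ a connected component of $(G/\Gamma)\setminus K_n$. -/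

import Mathlib

open MeasureTheory Set
open scoped NNReal ENNReal

/-! ### Components of the complement of a compact set, and ends -/

/-- `C` is a connected component of the subset `F` of `X`. -/
def IsComponentOf {X : Type*} [TopologicalSpace X] (C F : Set X) : Prop :=
  ∃ x ∈ F, C = connectedComponentIn F x

/-- Exactly one infinite volume end: for every compact `K`, the complement of `K` has exactly one
connected component of infinite `μ`-measure. -/
def HasExactlyOneInfiniteVolumeEnd {X : Type*} [TopologicalSpace X] [MeasurableSpace X]
    (μ : Measure X) : Prop :=
  ∀ K : Set X, IsCompact K → ∃! C : Set X, IsComponentOf C Kᶜ ∧ μ C = ∞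

/-- An increasing sequence of compact sets whose interiors cover `X`. -/
structure IsExhaustion {X : Type*} [TopologicalSpace X] (K : ℕ → Set X) : Prop where
  mono : Monotone K
  isCompact : ∀ n, IsCompact (K n)
  cover : ⋃ n, interior (K n) = univ

/-- The ends of `X`, computed with the exhaustion `K`: decreasing sequences of open sets `U n`
with `U n` a connected component of the complement of `K n`. -/
def endsOf {X : Type*} [TopologicalSpace X] (K : ℕ → Set X) : Set (ℕ → Set X) :=
  {U | ∀ n, IsOpen (U n) ∧ IsComponentOf (U n) (K n)ᶜ ∧ U (n + 1) ⊆ U n}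

/-- The space of ends has exactly one point, whichever compact exhaustion is used. -/
def HasExactlyOneEnd (X : Type*) [TopologicalSpace X] : Prop :=
  ∀ K : ℕ → Set X, IsExhaustion K → ∃! U : ℕ → Set X, U ∈ endsOf K

/-! ### Unitary representations and property (T) -/

/-- A unitary representation is strongly continuous if all its orbit maps are continuous. -/
def IsStronglyContinuous {G H : Type*} [Group G] [TopologicalSpace G]
    [NormedAddCommGroup H] [InnerProductSpace ℂ H] (π : G →* (H ≃ₗᵢ[ℂ] H)) : Prop :=
  ∀ ξ : H, Continuous fun g : G => π g ξ

/-- Kazhdan's property (T): there are a compact set `Q` and `ε > 0` such that every strongly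
continuous unitary representation on a complex Hilbert space that has a `(Q, ε)`-invariant vector
has a nonzero invariant vector. -/
def HasPropertyT.{u} (G : Type u) [Group G] [TopologicalSpace G] : Prop :=
  ∃ Q : Set G, IsCompact Q ∧ ∃ ε : ℝ, 0 < ε ∧
    ∀ (H : Type u) [NormedAddCommGroup H] [InnerProductSpace ℂ H] [CompleteSpace H]
      (π : G →* (H ≃ₗᵢ[ℂ] H)), IsStronglyContinuous π →
      (∃ ξ : H, ξ ≠ 0 ∧ ∀ g ∈ Q, ‖π g ξ - ξ‖ < ε * ‖ξ‖) →
      ∃ η : H, η ≠ 0 ∧ ∀ g : G, π g η = η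

/-! ### The Koopman representation -/

/-- The measure is multiplied by a constant under every element of the group. (The constants then
form a homomorphism into the positive reals if the measure is nonzero and Radon; an invariant
measure is the case where all of them are `1`.) -/
def IsRelativelyInvariant (G : Type*) {X : Type*} [Group G] [MulAction G X] [MeasurableSpace X]
    (μ : Measure X) : Prop :=
  ∀ g : G, ∃ c : ℝ≥0, μ.map (fun x => g • x) = c • μ

/-- The Koopman representation of a measure class preserving action on complex functions,
`(κ(g) f)(x) = f(g⁻¹ x) (d(g_* μ)/dμ)^{1/2}(x)`. It preserves almost everywhere equality and the
`L²`-norm. -/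
noncomputable def koopman {G X : Type*} [Group G] [MulAction G X] [MeasurableSpace X]
    (μ : Measure X) (g : G) (f : X → ℂ) : X → ℂ :=
  fun x => (√(((μ.map (fun y => g • y)).rnDeriv μ x).toReal) : ℂ) * f (g⁻¹ • x)

/-- `L²(X, μ)` has a nonzero vector that is invariant under the Koopman representation restricted
to the subgroup `H`. -/
def KoopmanHasInvariantVector {G X : Type*} [Group G] [MulAction G X] [MeasurableSpace X]
    (μ : Measure X) (H : Subgroup G) : Prop :=
  ∃ f : Lp ℂ 2 μ, f ≠ 0 ∧ ∀ h ∈ H, koopman μ h f =ᵐ[μ] f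

/-- `L²(X, μ)` has almost invariant vectors for the Koopman representation restricted to the
subgroup `H`, which carries the subspace topology; in other words, this restriction weakly contains
the trivial representation. -/
def KoopmanHasAlmostInvariantVectors {G X : Type*} [Group G] [TopologicalSpace G] [MulAction G X]
    [MeasurableSpace X] (μ : Measure X) (H : Subgroup G) : Prop :=
  ∀ Q : Set G, Q ⊆ H → IsCompact Q → ∀ ε : ℝ, 0 < ε →
    ∃ f : Lp ℂ 2 μ, f ≠ 0 ∧
      ∀ h ∈ Q, eLpNorm (koopman μ h f - ⇑f) 2 μ < ENNReal.ofReal (ε * ‖f‖)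

/-- `Γ` is coamenable in `G`: the Koopman representation of `G` on `L²(G/Γ, μ)` weakly contains the
trivial representation. -/
def IsCoamenable {G : Type*} [Group G] [TopologicalSpace G] (Γ : Subgroup G)
    [MeasurableSpace (G ⧸ Γ)] (μ : Measure (G ⧸ Γ)) : Prop :=
  KoopmanHasAlmostInvariantVectors μ (⊤ : Subgroup G)

/-! ### Unimodularity and injectivity radius -/

/-- The modular character is trivial. -/
def IsUnimodularGroup (G : Type*) [Group G] [TopologicalSpace G] [IsTopologicalGroup G]
    [LocallyCompactSpace G] : Prop :=
  ∀ g : G, Measure.modularCharacter g = 1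

/-- The injectivity radius of `G/Γ` is bounded away from `0`: there is a relatively compact
neighbourhood `U` of the identity such that all orbit maps `g ↦ g • x`, `x ∈ G/Γ`, are injective
on `U`. -/
def InjectivityRadiusBoundedBelow {G : Type*} [Group G] [TopologicalSpace G]
    (Γ : Subgroup G) : Prop :=
  ∃ U ∈ nhds (1 : G), IsCompact (closure U) ∧ ∀ x : G ⧸ Γ, InjOn (fun g : G => g • x) U

/-! ### The chain condition -/

/-- `G` is generated by a sequence of subgroups `S n` such that `S n` commutes with `S (n + 1)` and
`L²(G/Γ, μ)` has no nonzero `S n`-invariant vector, for every `n`, and such that, for some `i`,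
`L²(G/Γ, μ)` has no `S i`-almost invariant vectors. -/
def IsGeneratedByCommutingChain {G : Type*} [Group G] [TopologicalSpace G] (Γ : Subgroup G)
    [MeasurableSpace (G ⧸ Γ)] (μ : Measure (G ⧸ Γ)) : Prop :=
  ∃ S : ℕ → Subgroup G, (⨆ n, S n) = ⊤ ∧
    (∀ n, ∀ g ∈ S n, ∀ h ∈ S (n + 1), g * h = h * g) ∧
    (∀ n, ¬ KoopmanHasInvariantVector μ (S n)) ∧
    ∃ i, ¬ KoopmanHasAlmostInvariantVectors μ (S i)

open Topology Filter Pointwise unitInterval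

/-! Ends are turned into cohomology. Let `c` be the character with `g_* μ = c g • μ`, and let `w >
0` be continuous with `s g * √(c g) * w (g⁻¹ • x) = w x` for a positive character `s`. Given `D`
with compact frontier, let `E` be continuous and equal to the indicator of `D` off a compact set. As
`G` is connected, `b g = w * (E ∘ g⁻¹ - E)` has compact support, so `b` is an `L²` cocycle of `s •
κ`, with `κ` the Koopman representation. If `b` is a coboundary, with vector `v`, then `v / w + E`
is `G`-invariant, hence a constant `a` by transitivity. So `w * (a - E)` is square integrable, and
`D` or its complement has finite mass for `w² μ` (`withDensity_lt_top_or_compl_lt_top`). Two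
infinite components are thus impossible. One exists because otherwise the total mass is finite and
`w` is an invariant vector in `L²`, against non-coamenability.

The cocycles are coboundaries for two reasons. Under property (T), `s` is trivial, cocycles are
bounded by Delorme's argument (`HasPropertyT.exists_bound_of_cocycle`), and a Chebyshev center is a
fixed point. For a commuting chain (`exists_fixedPoint_of_commuting_chain`), one subgroup has a
fixed point for the affine action, by contraction or by spectral gap. It is unique for lack of
invariant vectors, hence fixed by the neighbouring subgroups and so by all of them.

Two choices of `w` are used. `w = 1` with `s = c^(-1/2)` gives the statement for `μ`. For unimodular
`G` and injectivity radius bounded below, `√c` descends to `G/Γ`; taking it as `w` with `s = 1`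
gives an invariant measure (`exists_invariant_density`). All translates of a small neighbourhood
then have the same mass, so a component that is not relatively compact has infinite mass, and volume
ends detect topological ends. -/

/-! ### Local connectedness and compact connected sets -/

theorem IsClosed.isClosed_connectedComponentIn {X : Type*} [TopologicalSpace X] {F : Set X}
    (hF : IsClosed F) (x : X) : IsClosed (connectedComponentIn F x) := by
  by_cases hx : x ∈ F
  · refine isClosed_of_closure_subset ?_
    exact isPreconnected_connectedComponentIn.closure.subset_connectedComponentIn
      (subset_closure (mem_connectedComponentIn hx))
      (closure_minimal (connectedComponentIn_subset _ _) hF)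
  · rw [connectedComponentIn_eq_empty hx]
    exact isClosed_empty

/-- In a path connected group, the identity component of a compact neighbourhood of the identity has
nonempty interior: countably many of its translates cover the group. -/
theorem nonempty_interior_connectedComponentIn_one {G : Type*} [Group G] [TopologicalSpace G]
    [IsTopologicalGroup G] [T2Space G] [LocallyCompactSpace G] [SecondCountableTopology G]
    [PathConnectedSpace G] {U : Set G} (hU : U ∈ 𝓝 (1 : G)) (hUc : IsCompact U) :
    (interior (connectedComponentIn U 1)).Nonempty := by
  have h1U : (1 : G) ∈ U := mem_of_mem_nhds hU
  have hCc : IsClosed (connectedComponentIn U 1) :=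
    hUc.isClosed.isClosed_connectedComponentIn _
  -- The path space is second countable. If `γ⁻¹ * δ` stays in `U`, the endpoint of `δ` lies in the
  -- translate by `γ 1` of the component, so countably many `γ` suffice and Baire applies.
  let P : Set C(I, G) := {γ | γ 0 = 1}
  have hN : ∀ γ : P, {δ : P | MapsTo (γ.1⁻¹ * δ.1 : C(I, G)) univ (interior U)} ∈ 𝓝 γ := by
    intro γ
    refine IsOpen.mem_nhds ?_ ?_
    · exact (ContinuousMap.isOpen_setOfPred_mapsTo isCompact_univ isOpen_interior).preimage
        (continuous_const.mul continuous_subtype_val)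
    · intro t _
      simpa using mem_interior_iff_mem_nhds.2 hU
  obtain ⟨s, hsc, hs⟩ := TopologicalSpace.countable_cover_nhds hN
  have : Countable s := hsc
  have hcl : ∀ γ : s, IsClosed (γ.1.1 1 • connectedComponentIn U (1 : G)) :=
    fun γ => hCc.smul _
  have hcov : ⋃ γ : s, γ.1.1 1 • connectedComponentIn U (1 : G) = univ := by
    refine eq_univ_of_forall fun g => ?_
    obtain ⟨p⟩ := PathConnectedSpace.joined (1 : G) g
    have hp : (⟨p.toContinuousMap, by simp [P]⟩ : P) ∈ (univ : Set P) := mem_univ _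
    rw [← hs] at hp
    simp only [mem_iUnion] at hp
    obtain ⟨γ, hγ, hmem⟩ := hp
    refine mem_iUnion.2 ⟨⟨γ, hγ⟩, ?_⟩
    rw [mem_smul_set_iff_inv_smul_mem]
    have hmem' : MapsTo (fun t : I => (γ.1 t)⁻¹ * p t) univ (interior U) := hmem
    have hpre : IsPreconnected ((fun t : I => (γ.1 t)⁻¹ * p t) '' univ) :=
      isPreconnected_univ.image _ (by fun_prop)
    refine hpre.subset_connectedComponentIn ⟨0, mem_univ _, by simp [show γ.1 0 = 1 from γ.2]⟩ ?_
      ⟨1, mem_univ _, by simp⟩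
    rintro _ ⟨t, ht, rfl⟩
    exact interior_subset (hmem' ht)
  obtain ⟨γ, hγ⟩ := nonempty_interior_of_iUnion_of_closed hcl hcov
  rw [interior_smul] at hγ
  exact smul_set_nonempty.1 hγ

/-- A path connected, second countable, locally compact group is locally connected. -/
theorem LocallyConnectedSpace.of_pathConnected_group {G : Type*} [Group G] [TopologicalSpace G]
    [IsTopologicalGroup G] [T2Space G] [LocallyCompactSpace G] [SecondCountableTopology G]
    [PathConnectedSpace G] : LocallyConnectedSpace G := by
  have key : ∀ W ∈ 𝓝 (1 : G), ∃ V ∈ 𝓝 (1 : G), IsPreconnected V ∧ V ⊆ W := by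
    intro W hW
    have hdiv : Tendsto (fun p : G × G => p.1⁻¹ * p.2) (𝓝 (1, 1)) (𝓝 1) := by
      have : Continuous (fun p : G × G => p.1⁻¹ * p.2) := by fun_prop
      simpa using this.tendsto (1, 1)
    have h1 := hdiv hW
    rw [nhds_prod_eq, mem_map, mem_prod_same_iff] at h1
    obtain ⟨W', hW', hsub⟩ := h1
    obtain ⟨U, hU, hUW, hUc⟩ := local_compact_nhds hW'
    obtain ⟨y, hy⟩ := nonempty_interior_connectedComponentIn_one hU hUc
    set C := connectedComponentIn U (1 : G)
    -- `C` has an interior point, perhaps not `1`; the quotients `C⁻¹ * C` are still connected and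
    -- contain a neighbourhood of `1`.
    refine ⟨(fun p : G × G => p.1⁻¹ * p.2) '' (C ×ˢ C), ?_, ?_, ?_⟩
    · have hop : IsOpen ((fun z => y * z) ⁻¹' interior C) :=
        isOpen_interior.preimage (continuous_const_mul y)
      refine Filter.mem_of_superset (hop.mem_nhds (by simpa using hy)) ?_
      intro z hz
      exact ⟨(y, y * z), ⟨interior_subset hy, interior_subset hz⟩, by simp⟩
    · exact (isPreconnected_connectedComponentIn.prod isPreconnected_connectedComponentIn).image _
        (by fun_prop)
    · rintro _ ⟨p, hp, rfl⟩
      exact hsub ⟨hUW (connectedComponentIn_subset _ _ hp.1),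
        hUW (connectedComponentIn_subset _ _ hp.2)⟩
  rw [locallyConnectedSpace_iff_connected_subsets]
  intro x U hU
  obtain ⟨V, hV, hVc, hVU⟩ := key ((fun z => x * z) ⁻¹' U)
    ((continuous_const_mul x).continuousAt.preimage_mem_nhds (by simpa using hU))
  refine ⟨(fun z => x * z) '' V, ?_, hVc.image _ (continuous_const_mul x).continuousOn, ?_⟩
  · simpa using (Homeomorph.mulLeft x).isOpenMap.image_mem_nhds hV
  · rintro _ ⟨z, hz, rfl⟩
    exact hVU hz

/-- The image of a locally connected space under a continuous open surjection is locally
connected. -/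
theorem IsOpenQuotientMap.locallyConnectedSpace {X Y : Type*} [TopologicalSpace X]
    [TopologicalSpace Y] [LocallyConnectedSpace X] {f : X → Y} (hf : IsOpenQuotientMap f) :
    LocallyConnectedSpace Y := by
  rw [locallyConnectedSpace_iff_connected_subsets]
  intro y U hU
  obtain ⟨x, rfl⟩ := hf.surjective y
  refine ⟨f '' connectedComponentIn (f ⁻¹' U) x, ?_, ?_, ?_⟩
  · exact hf.isOpenMap.image_mem_nhds
      (connectedComponentIn_mem_nhds (hf.continuous.continuousAt.preimage_mem_nhds hU))
  · exact isPreconnected_connectedComponentIn.image _ hf.continuous.continuousOn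
  · rintro _ ⟨z, hz, rfl⟩
    exact connectedComponentIn_subset (f ⁻¹' U) _ hz

/-- In a path connected, locally connected, locally compact space, every compact set is contained
in a compact connected set. -/
theorem IsCompact.exists_isCompact_isPreconnected_superset {X : Type*} [TopologicalSpace X]
    [T2Space X] [LocallyCompactSpace X] [LocallyConnectedSpace X] [PathConnectedSpace X]
    {Q : Set X} (hQ : IsCompact Q) (x₀ : X) :
    ∃ L : Set X, IsCompact L ∧ IsPreconnected L ∧ x₀ ∈ L ∧ Q ⊆ L := by
  have hloc : ∀ x : X, ∃ L ∈ 𝓝 x, IsCompact L ∧ IsPreconnected L ∧ x₀ ∈ L := by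
    intro x
    obtain ⟨N, hNc, hN⟩ := exists_compact_mem_nhds x
    obtain ⟨p⟩ := PathConnectedSpace.joined x₀ x
    refine ⟨range p ∪ connectedComponentIn N x, ?_, ?_, ?_, Or.inl ⟨0, by simp⟩⟩
    · exact mem_of_superset (connectedComponentIn_mem_nhds hN) subset_union_right
    · exact (isCompact_range p.continuous).union
        (hNc.of_isClosed_subset (hNc.isClosed.isClosed_connectedComponentIn _)
          (connectedComponentIn_subset _ _))
    · exact (isPreconnected_range p.continuous).union x ⟨1, by simp⟩
        (mem_connectedComponentIn (mem_of_mem_nhds hN)) isPreconnected_connectedComponentIn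
  choose L hL hLc hLp hx₀ using hloc
  obtain ⟨t, ht⟩ := hQ.elim_nhds_subcover L (fun x _ => hL x)
  refine ⟨L x₀ ∪ ⋃ x ∈ t, L x, ?_, ?_, Or.inl (hx₀ x₀), ht.2.trans subset_union_right⟩
  · exact (hLc x₀).union (t.isCompact_biUnion fun x _ => hLc x)
  · have : L x₀ ∪ ⋃ x ∈ t, L x = ⋃₀ ({L x₀} ∪ L '' t) := by
      simp
    rw [this]
    refine isPreconnected_sUnion x₀ _ ?_ ?_
    · rintro _ (rfl | ⟨x, -, rfl⟩) <;> exact hx₀ _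
    · rintro _ (rfl | ⟨x, -, rfl⟩) <;> exact hLp _

/-- A preconnected set that does not meet the frontier of `D` lies in `D` or in its complement. -/
theorem IsPreconnected.subset_or_subset_compl_of_disjoint_frontier {X : Type*} [TopologicalSpace X]
    {S D : Set X} (hS : IsPreconnected S) (h : ∀ x ∈ S, x ∉ frontier D) : S ⊆ D ∨ S ⊆ Dᶜ := by
  have hcov : S ⊆ interior D ∪ interior Dᶜ := by
    intro x hx
    have := h x hx
    rw [frontier_eq_closure_inter_closure, closure_compl, ← compl_compl (closure D),
      ← interior_compl] at this
    simp only [mem_inter_iff, mem_compl_iff, not_and, not_not] at this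
    by_cases hx' : x ∈ interior Dᶜ
    · exact Or.inr hx'
    · exact Or.inl (this hx')
  have hdisj : Disjoint (interior D) (interior Dᶜ) :=
    disjoint_compl_right.mono interior_subset interior_subset
  rcases hS.subset_or_subset isOpen_interior isOpen_interior hdisj hcov with h | h
  · exact Or.inl (h.trans interior_subset)
  · exact Or.inr (h.trans interior_subset)

/-! ### Components of complements of compact sets -/

section Components

variable {X : Type*} [TopologicalSpace X] [LocallyConnectedSpace X]

theorem IsComponentOf.isPreconnected {X : Type*} [TopologicalSpace X] {C F : Set X}
    (h : IsComponentOf C F) : IsPreconnected C := by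
  obtain ⟨x, -, rfl⟩ := h
  exact isPreconnected_connectedComponentIn

theorem IsComponentOf.nonempty {X : Type*} [TopologicalSpace X] {C F : Set X}
    (h : IsComponentOf C F) : C.Nonempty := by
  obtain ⟨x, hx, rfl⟩ := h
  exact ⟨x, mem_connectedComponentIn hx⟩

theorem IsComponentOf.subset {X : Type*} [TopologicalSpace X] {C F : Set X}
    (h : IsComponentOf C F) : C ⊆ F := by
  obtain ⟨x, hx, rfl⟩ := h
  exact connectedComponentIn_subset _ _

theorem IsComponentOf.eq_connectedComponentIn {X : Type*} [TopologicalSpace X] {C F : Set X}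
    (h : IsComponentOf C F) {x : X} (hx : x ∈ C) : C = connectedComponentIn F x := by
  obtain ⟨y, hy, rfl⟩ := h
  exact connectedComponentIn_eq hx

theorem IsComponentOf.isOpen {C F : Set X} (h : IsComponentOf C F) (hF : IsOpen F) : IsOpen C := by
  obtain ⟨x, -, rfl⟩ := h
  exact hF.connectedComponentIn

/-- By local connectedness a frontier point outside `K` has an open component of `Kᶜ` around it;
this meets `C`, so it equals `C`, although `C` is open and omits its frontier. -/
theorem IsComponentOf.frontier_subset {C K : Set X} (h : IsComponentOf C Kᶜ) (hK : IsClosed K) :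
    frontier C ⊆ K := by
  intro x hx
  by_contra hxK
  have hxC : x ∉ C := fun hxC => by
    have := hx.2
    rw [(h.isOpen hK.isOpen_compl).interior_eq] at this
    exact this hxC
  obtain ⟨y, hy1, hy2⟩ := mem_closure_iff.1 hx.1 _ hK.isOpen_compl.connectedComponentIn
    (mem_connectedComponentIn (show x ∈ Kᶜ from hxK))
  apply hxC
  rw [h.eq_connectedComponentIn hy2, ← connectedComponentIn_eq hy1]
  exact mem_connectedComponentIn hxK

/-- If `ν` is infinite, and finite on compact sets, then some component of the complement of a
compact set has infinite measure. -/
theorem exists_isComponentOf_compl_measure_eq_top [T2Space X] [LocallyCompactSpace X]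
    [ConnectedSpace X] [MeasurableSpace X] (ν : Measure X) [IsFiniteMeasureOnCompacts ν]
    (hν : ν univ = ∞) {K : Set X} (hK : IsCompact K) :
    ∃ C, IsComponentOf C Kᶜ ∧ ν C = ∞ := by
  rcases K.eq_empty_or_nonempty with rfl | hKne
  · obtain ⟨x⟩ := (inferInstance : Nonempty X)
    exact ⟨univ, ⟨x, by simp, by simp [connectedComponentIn_univ]⟩, hν⟩
  by_contra! hfin
  obtain ⟨K', hK', hKK'⟩ := exists_compact_superset hK
  have hfrK' : frontier K' ⊆ Kᶜ := fun x hx hxK => hx.2 (hKK' hxK)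
  have hfc : IsCompact (frontier K') :=
    hK'.of_isClosed_subset isClosed_frontier hK'.isClosed.frontier_subset
  obtain ⟨t, htf, ht⟩ := hfc.elim_nhds_subcover (fun x => connectedComponentIn Kᶜ x)
    (fun x hx => hK.isClosed.isOpen_compl.connectedComponentIn.mem_nhds
      (mem_connectedComponentIn (hfrK' hx)))
  -- A component of `Kᶜ` through a point outside `K'` must meet `frontier K'`. Otherwise its closure
  -- avoids `interior K' ⊇ K`, while its frontier lies in `K`; it would be clopen.
  have hcov : (univ : Set X) ⊆ K' ∪ ⋃ x ∈ t, connectedComponentIn Kᶜ x := by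
    intro x _
    by_cases hxK' : x ∈ K'
    · exact Or.inl hxK'
    right
    have hxK : x ∈ Kᶜ := fun h => hxK' (interior_subset (hKK' h))
    set C := connectedComponentIn Kᶜ x with hC
    have hCc : IsComponentOf C Kᶜ := ⟨x, hxK, rfl⟩
    have hxC : x ∈ C := mem_connectedComponentIn hxK
    have hmeet : ∃ y ∈ C, y ∈ frontier K' := by
      by_contra! hno
      rcases hCc.isPreconnected.subset_or_subset_compl_of_disjoint_frontier hno with h | h
      · exact hxK' (h hxC)
      · have hcl : closure C ⊆ (interior K')ᶜ := by
          rw [← closure_compl]; exact closure_mono h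
        have hfr : frontier C = ∅ := by
          refine eq_empty_of_forall_notMem fun y hy => ?_
          exact hcl hy.1 (hKK' (hCc.frontier_subset hK.isClosed hy))
        rcases frontier_eq_empty_iff.1 hfr with h' | h'
        · rw [h'] at hxC; exact hxC
        · obtain ⟨k, hk⟩ := hKne
          exact hCc.subset (h' ▸ mem_univ k) hk
    obtain ⟨y, hyC, hyf⟩ := hmeet
    obtain ⟨z, hz, hyz⟩ := mem_iUnion₂.1 (ht hyf)
    refine mem_iUnion₂.2 ⟨z, hz, ?_⟩
    rw [connectedComponentIn_eq hyz, ← connectedComponentIn_eq hyC]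
    exact hxC
  have : ν univ < ∞ := by
    refine (measure_mono hcov).trans_lt ((measure_union_le _ _).trans_lt ?_)
    refine ENNReal.add_lt_top.2 ⟨hK'.measure_lt_top, ?_⟩
    refine (measure_biUnion_finset_le _ _).trans_lt (ENNReal.sum_lt_top.2 fun x hx => ?_)
    exact lt_top_iff_ne_top.2 (hfin _ ⟨x, hfrK' (htf x hx), rfl⟩)
  exact this.ne hν

end Components

/-! ### Fixed points of affine actions on Hilbert spaces -/

section AffineActions

variable {H : Type*} [NormedAddCommGroup H] [InnerProductSpace ℂ H]

theorem norm_midpoint_sub_sq (x y z : H) :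
    ‖(1 / 2 : ℂ) • (x + y) - z‖ ^ 2 =
      (‖x - z‖ ^ 2 + ‖y - z‖ ^ 2) / 2 - ‖x - y‖ ^ 2 / 4 := by
  have h := parallelogram_law_with_norm ℂ (x - z) (y - z)
  have h1 : (1 / 2 : ℂ) • (x + y) - z = (1 / 2 : ℂ) • ((x - z) + (y - z)) := by
    module
  have h2 : (x - z) - (y - z) = x - y := by abel
  rw [h2] at h
  rw [h1, norm_smul]
  norm_num
  nlinarith

/-- A bounded family in a Hilbert space has a Chebyshev center: there are `c` and `d` such that the
closed ball of radius `√d` around `c`, and around no other point, contains the family. -/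
theorem exists_chebyshevCenter [CompleteSpace H] {ι : Type*} [Nonempty ι] (e : ι → H) {M : ℝ}
    (hM : ∀ i, ‖e i‖ ≤ M) :
    ∃ (c : H) (d : ℝ), (∀ i, ‖c - e i‖ ^ 2 ≤ d) ∧ ∀ x, (∀ i, ‖x - e i‖ ^ 2 ≤ d) → x = c := by
  let A : Set ℝ := {r | ∃ x : H, ∀ i, ‖x - e i‖ ^ 2 ≤ r}
  have hAne : A.Nonempty := ⟨M ^ 2, 0, fun i => by
    rw [zero_sub, norm_neg]
    exact pow_le_pow_left₀ (norm_nonneg _) (hM i) 2⟩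
  obtain ⟨i₀⟩ := (inferInstance : Nonempty ι)
  have hAb : BddBelow A := ⟨0, fun r ⟨x, hx⟩ => (sq_nonneg _).trans (hx i₀)⟩
  set d := sInf A
  -- Near-minimizers are close: the midpoint lowers the squared radius by `‖x - y‖ ^ 2 / 4`, and the
  -- radius cannot fall below the infimum.
  have hclose : ∀ (x y : H) (r : ℝ), (∀ i, ‖x - e i‖ ^ 2 ≤ d + r) → (∀ i, ‖y - e i‖ ^ 2 ≤ d + r) →
      ‖x - y‖ ^ 2 ≤ 4 * r := by
    intro x y r hx hy
    have : d ≤ d + r - ‖x - y‖ ^ 2 / 4 := csInf_le hAb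
      ⟨(1 / 2 : ℂ) • (x + y), fun i => by
        rw [norm_midpoint_sub_sq]
        linarith [hx i, hy i]⟩
    linarith
  have hex : ∀ n : ℕ, ∃ x : H, ∀ i, ‖x - e i‖ ^ 2 ≤ d + 1 / ((n : ℝ) + 1) := by
    intro n
    obtain ⟨r, ⟨x, hx⟩, hr⟩ := exists_lt_of_csInf_lt hAne
      (show sInf A < d + 1 / ((n : ℝ) + 1) from lt_add_of_pos_right _ (by positivity))
    exact ⟨x, fun i => (hx i).trans hr.le⟩
  choose u hu using hex
  have hlim : Tendsto (fun n : ℕ => 1 / ((n : ℝ) + 1)) atTop (𝓝 0) :=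
    tendsto_one_div_add_atTop_nhds_zero_nat
  have hcau : CauchySeq u := by
    refine cauchySeq_of_le_tendsto_0 (fun n => √(4 * (1 / ((n : ℝ) + 1)))) ?_ ?_
    · intro n m N hn hm
      rw [dist_eq_norm]
      refine Real.le_sqrt_of_sq_le (hclose _ _ _ (fun i => (hu n i).trans ?_)
        fun i => (hu m i).trans ?_) <;> gcongr
    · have := (hlim.const_mul 4).sqrt
      simpa using this
  obtain ⟨c, hc⟩ := cauchySeq_tendsto_of_complete hcau
  have hcd : ∀ i, ‖c - e i‖ ^ 2 ≤ d := by
    intro i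
    refine le_of_tendsto_of_tendsto (((hc.sub_const (e i)).norm).pow 2)
      (by simpa using hlim.const_add d) (Eventually.of_forall fun n => hu n i)
  refine ⟨c, d, hcd, fun x hx => ?_⟩
  have := hclose x c 0 (by simpa using hx) (by simpa using hcd)
  have h0 : ‖x - c‖ = 0 := by
    have := sq_nonneg ‖x - c‖
    exact pow_eq_zero_iff (two_ne_zero) |>.1 (by linarith)
  exact sub_eq_zero.1 (norm_eq_zero.1 h0)

/-- A bounded cocycle of a unitary representation is a coboundary. -/
theorem exists_fixedPoint_of_bounded_cocycle [CompleteSpace H] {G : Type*} [Group G]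
    (κ : G →* (H ≃ₗᵢ[ℂ] H)) (b : G → H) (hb : ∀ g h, b (g * h) = b g + κ g (b h)) {M : ℝ}
    (hM : ∀ g, ‖b g‖ ≤ M) : ∃ v, ∀ g, κ g v + b g = v := by
  obtain ⟨c, d, hcd, huniq⟩ := exists_chebyshevCenter b hM
  -- The affine action permutes the orbit `b` of `0`, so it fixes the center of that orbit.
  refine ⟨c, fun h => huniq _ fun g => ?_⟩
  have : κ h c + b h - b g = κ h (c - b (h⁻¹ * g)) := by
    have := hb h (h⁻¹ * g)
    rw [mul_inv_cancel_left] at this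
    rw [this, map_sub]
    abel
  rw [this, LinearIsometryEquiv.norm_map]
  exact hcd _

/-- Let `κ` be a unitary representation and `s` a positive character of a group generated by a
chain of commuting subgroups without `κ`-invariant vectors. If a cocycle `b` of `s • κ` is bounded
on a subset `Q` of one of the subgroups, for which `κ` has a spectral gap, then `b` is a
coboundary. -/
theorem exists_fixedPoint_of_commuting_chain [CompleteSpace H] {G : Type*} [Group G]
    (κ : G →* (H ≃ₗᵢ[ℂ] H)) (s : G →* ℝ) (hs : ∀ g, 0 < s g) (b : G → H)
    (hb : ∀ g h, b (g * h) = b g + s g • κ g (b h))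
    (S : ℕ → Subgroup G) (hS : ⨆ n, S n = ⊤)
    (hcomm : ∀ n, ∀ g ∈ S n, ∀ h ∈ S (n + 1), g * h = h * g)
    (hinv : ∀ n v, (∀ h ∈ S n, κ h v = v) → v = 0)
    {i : ℕ} {Q : Set G} (hQ : Q ⊆ S i) {ε : ℝ} (hε : 0 < ε)
    (hgap : ∀ v, v ≠ 0 → ∃ h ∈ Q, ε * ‖v‖ ≤ ‖κ h v - v‖) {M : ℝ} (hM : ∀ h ∈ Q, ‖b h‖ ≤ M) :
    ∃ v, ∀ g, s g • κ g v + b g = v := by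
  let α : G → H → H := fun g v => s g • κ g v + b g
  have hαmul : ∀ g h v, α (g * h) v = α g (α h v) := by
    intro g h v
    have h1 : κ g (s h • κ h v) = s h • κ g (κ h v) :=
      (κ g).toLinearEquiv.toLinearMap.map_smul_of_tower (s h) _
    have h2 : (κ g * κ h) v = κ g (κ h v) := rfl
    simp only [α, map_mul, hb, map_add, h1, h2, smul_add, mul_smul]
    abel
  have hαone : ∀ v, α 1 v = v := by
    intro v
    have := hb 1 1
    simp at this
    simp [α, this]
  have hdiff : ∀ g v w, α g v - α g w = s g • κ g (v - w) := by
    intro g v w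
    simp [α, map_sub, smul_sub]
  have hαinv : ∀ g v, α g v = v → α g⁻¹ v = v := by
    intro g v h
    conv_lhs => rw [← h]
    rw [← hαmul, inv_mul_cancel, hαone]
  have hndiff : ∀ g v w, ‖α g v - α g w‖ = s g * ‖v - w‖ := by
    intro g v w
    rw [hdiff, norm_smul, LinearIsometryEquiv.norm_map, Real.norm_of_nonneg (hs g).le]
  -- `α g` scales distances by `s g`, so two distinct fixed points force `s g = 1`, and their
  -- difference is `κ`-invariant.
  have huniq : ∀ n v w, (∀ g ∈ S n, α g v = v) → (∀ g ∈ S n, α g w = w) → v = w := by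
    intro n v w hv hw
    by_contra hne
    have hne' : v - w ≠ 0 := sub_ne_zero.2 hne
    apply hne'
    refine hinv n _ fun g hg => ?_
    have h1 := hndiff g v w
    rw [hv g hg, hw g hg] at h1
    have hs1 : s g = 1 := by
      have : 0 < ‖v - w‖ := norm_pos_iff.2 hne'
      nlinarith
    have h2 := hdiff g v w
    rw [hv g hg, hw g hg, hs1, one_smul] at h2
    exact h2.symm
  -- A commuting subgroup permutes the fixed points of `S n`, of which there is at most one.
  have hspread : ∀ n m v, (∀ g ∈ S n, ∀ h ∈ S m, g * h = h * g) → (∀ g ∈ S n, α g v = v) →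
      ∀ h ∈ S m, α h v = v := by
    intro n m v hnm hv h hh
    refine huniq n _ _ (fun g hg => ?_) hv
    rw [← hαmul, hnm g hg h hh, hαmul, hv g hg]
  have hup : ∀ n v, (∀ g ∈ S n, α g v = v) → ∀ g ∈ S (n + 1), α g v = v :=
    fun n v hv => hspread n (n + 1) v (hcomm n) hv
  have hdown : ∀ n v, (∀ g ∈ S (n + 1), α g v = v) → ∀ g ∈ S n, α g v = v :=
    fun n v hv => hspread (n + 1) n v (fun g hg h hh => (hcomm n h hh g hg).symm) hv
  have hone : ∃ j v, ∀ g ∈ S j, α g v = v := by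
    -- If some `s g < 1`, then `α g` is a contraction, and its only fixed point is preserved by
    -- everything commuting with `g`. If not, passing to inverses gives `s = 1` on every `S j`.
    by_cases hs1 : ∃ j, ∃ g ∈ S j, s g < 1
    · obtain ⟨j, g, hg, hlt⟩ := hs1
      have hcontr : ContractingWith ⟨s g, (hs g).le⟩ (α g) := by
        refine ⟨by exact_mod_cast hlt, LipschitzWith.of_dist_le_mul fun v w => ?_⟩
        rw [dist_eq_norm, dist_eq_norm, hndiff]
        rfl
      refine ⟨j + 1, hcontr.fixedPoint, fun h hh => ?_⟩
      refine hcontr.fixedPoint_unique ?_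
      change α g (α h _) = _
      rw [← hαmul, hcomm j g hg h hh, hαmul]
      congr 1
      exact hcontr.fixedPoint_isFixedPt
    · push Not at hs1
      have hs1 : ∀ j, ∀ g ∈ S j, s g = 1 := by
        intro j g hg
        refine le_antisymm ?_ (hs1 j g hg)
        have h1 := hs1 j g⁻¹ (inv_mem hg)
        have h2 : s g⁻¹ * s g = 1 := by rw [← map_mul, inv_mul_cancel, map_one]
        nlinarith [hs g, hs g⁻¹]
      -- Expanding `b (g * h) = b (h * g)` both ways shows that `κ g` moves `b h` exactly as `κ h`
      -- moves `b g`, by at most `2 * M`. The spectral gap then bounds `b h`.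
      have hbound : ∀ h ∈ S (i + 1), ‖b h‖ ≤ 2 * |M| / ε := by
        intro h hh
        by_cases hbh : b h = 0
        · rw [hbh, norm_zero]
          positivity
        · obtain ⟨g, hg, hgε⟩ := hgap _ hbh
          have h1 := hb g h
          rw [hcomm i g (hQ hg) h hh, hb h g, hs1 i g (hQ hg), hs1 _ h hh, one_smul, one_smul] at h1
          have h2 : κ g (b h) - b h = κ h (b g) - b g := by
            rw [sub_eq_sub_iff_add_eq_add, add_comm, ← h1, add_comm]
          rw [h2] at hgε
          have h3 := norm_sub_le (κ h (b g)) (b g)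
          rw [LinearIsometryEquiv.norm_map] at h3
          have := (hM g hg).trans (le_abs_self M)
          rw [le_div_iff₀ hε]
          linarith
      obtain ⟨v, hv⟩ := exists_fixedPoint_of_bounded_cocycle (κ.comp (S (i + 1)).subtype)
        (fun g => b g) (fun g h => by
          have := hb g h
          rw [hs1 _ _ g.2, one_smul] at this
          exact this) (fun g => hbound g g.2)
      refine ⟨i + 1, v, fun g hg => ?_⟩
      have := hv ⟨g, hg⟩
      simp only [α, hs1 _ g hg, one_smul]
      exact this
  obtain ⟨j, v, hv⟩ := hone
  have h0 : ∀ g ∈ S 0, α g v = v := by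
    clear hM hgap hQ
    induction j with
    | zero => exact hv
    | succ j ih => exact ih (hdown j v hv)
  have hall : ∀ n, ∀ g ∈ S n, α g v = v := by
    intro n
    induction n with
    | zero => exact h0
    | succ n ih => exact hup n v ih
  let Fx : Subgroup G :=
    { carrier := {g | α g v = v}
      mul_mem' := fun {g h} hg hh => by
        change α (g * h) v = v
        rw [hαmul, show α h v = v from hh, show α g v = v from hg]
      one_mem' := hαone v
      inv_mem' := fun {g} hg => hαinv g v hg }
  have hFx : (⊤ : Subgroup G) ≤ Fx := hS ▸ iSup_le fun n g hg => hall n g hg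
  exact ⟨v, fun g => hFx (Subgroup.mem_top g)⟩

end AffineActions

/-! ### Positive definiteness of the Gaussian kernel -/

section PositiveDefinite

open Matrix ComplexOrder

theorem Matrix.PosSemidef.of_finset_submatrix {ι : Type*} {A : Matrix ι ι ℂ}
    (hA : ∀ s : Finset ι, (A.submatrix ((↑) : s → ι) (↑)).PosSemidef) : A.PosSemidef := by
  classical
  refine ⟨?_, fun x => ?_⟩
  · ext i j
    have h := (hA {i, j}).isHermitian.apply (⟨i, by simp⟩ : ({i, j} : Finset ι)) ⟨j, by simp⟩
    simpa using h
  · have h := (hA x.support).2 (Finsupp.subtypeDomain (· ∈ x.support) x)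
    convert h using 1
    simp [Finsupp.sum, ← Finset.sum_attach x.support, ← Finset.subtype_mem_eq_attach]

/-- Entrywise powers are positive by the Schur product theorem, and the Taylor coefficients of the
exponential are positive. -/
theorem Matrix.PosSemidef.map_exp {n : Type*} [Fintype n] {A : Matrix n n ℂ}
    (hA : A.PosSemidef) : (A.map Complex.exp).PosSemidef := by
  have hpow : ∀ k : ℕ, (A.map (· ^ k)).PosSemidef := by
    intro k
    induction k with
    | zero =>
      have : A.map (· ^ 0) = gram ℂ (fun _ : n => (1 : ℂ)) := by
        ext i j; simp
      rw [this]
      exact posSemidef_gram _ _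
    | succ k ih =>
      have : A.map (· ^ (k + 1)) = (A.map (· ^ k)) ⊙ A := by
        ext i j; simp [pow_succ]
      rw [this]
      exact ih.hadamard hA
  rw [posSemidef_iff_dotProduct_mulVec]
  refine ⟨?_, fun x => ?_⟩
  · ext i j
    have := hA.isHermitian.apply i j
    simp only [RCLike.star_def] at this
    simp [← Complex.exp_conj, this]
  · have hlim : Tendsto (fun N : ℕ => ∑ k ∈ Finset.range N,
        (1 / (k.factorial : ℂ)) * (star x ⬝ᵥ (A.map (· ^ k)) *ᵥ x)) atTop
        (𝓝 (star x ⬝ᵥ (A.map Complex.exp) *ᵥ x)) := by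
      have hentry : ∀ z : ℂ, Tendsto (fun N : ℕ => ∑ k ∈ Finset.range N, z ^ k / k.factorial) atTop
          (𝓝 (Complex.exp z)) := by
        intro z
        have := (NormedSpace.expSeries_div_hasSum_exp (𝔸 := ℂ) z).tendsto_sum_nat
        rwa [← Complex.exp_eq_exp_ℂ] at this
      have : ∀ N : ℕ, ∑ k ∈ Finset.range N,
          (1 / (k.factorial : ℂ)) * (star x ⬝ᵥ (A.map (· ^ k)) *ᵥ x) =
          ∑ i, star x i * ∑ j, (∑ k ∈ Finset.range N, (A i j) ^ k / k.factorial) * x j := by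
        intro N
        simp only [dotProduct, mulVec, Finset.mul_sum, Finset.sum_mul, map_apply]
        rw [Finset.sum_comm]
        refine Finset.sum_congr rfl fun i _ => ?_
        rw [Finset.sum_comm]
        refine Finset.sum_congr rfl fun j _ => Finset.sum_congr rfl fun k _ => ?_
        ring
      simp_rw [this]
      refine tendsto_finsetSum _ fun i _ => Tendsto.const_mul _ (tendsto_finsetSum _ fun j _ => ?_)
      exact (hentry _).mul_const _
    refine ge_of_tendsto' hlim fun N => Finset.sum_nonneg fun k _ => ?_
    refine mul_nonneg ?_ ((hpow k).dotProduct_mulVec_nonneg x)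
    rw [one_div, ← Complex.ofReal_natCast, ← Complex.ofReal_inv]
    exact Complex.zero_le_real.2 (by positivity)

/-- The Gaussian kernel of a Hilbert space is positive definite. -/
theorem posSemidef_exp_neg_norm_sub_sq {ι H : Type*} [NormedAddCommGroup H] [InnerProductSpace ℂ H]
    (e : ι → H) :
    (Matrix.of fun i j => ((Real.exp (-‖e i - e j‖ ^ 2) : ℝ) : ℂ)).PosSemidef := by
  refine Matrix.PosSemidef.of_finset_submatrix fun s => ?_
  have h1 : (gram ℂ (fun i : s => e i) + (gram ℂ (fun i : s => e i))ᵀ).PosSemidef :=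
    (posSemidef_gram _ _).add (posSemidef_gram _ _).transpose
  have h2 : (gram ℂ (fun i : s => ((Real.exp (-‖e i‖ ^ 2) : ℝ) : ℂ))).PosSemidef :=
    posSemidef_gram _ _
  -- From `-‖x - y‖² = -‖x‖² - ‖y‖² + 2 Re ⟪x, y⟫`: the first two terms give a rank-one Gram matrix,
  -- and the Gram matrix plus its transpose gives `2 Re ⟪x, y⟫`.
  have h3 : (Matrix.of fun i j => ((Real.exp (-‖e i - e j‖ ^ 2) : ℝ) : ℂ)).submatrix
      ((↑) : s → ι) (↑) = (gram ℂ (fun i : s => ((Real.exp (-‖e i‖ ^ 2) : ℝ) : ℂ))) ⊙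
        (gram ℂ (fun i : s => e i) + (gram ℂ (fun i : s => e i))ᵀ).map Complex.exp := by
    ext i j
    simp only [submatrix_apply, of_apply, hadamard_apply, gram_apply, map_apply, Matrix.add_apply,
      transpose_apply]
    rw [← inner_conj_symm (e j) (e i)]
    simp only [RCLike.inner_apply, Complex.conj_ofReal]
    rw [Complex.add_conj, ← Complex.ofReal_exp, ← Complex.ofReal_mul, ← Complex.ofReal_mul,
      ← Real.exp_add, ← Real.exp_add, norm_sub_sq (𝕜 := ℂ)]
    congr 2
    simp only [RCLike.re_to_complex]
    ring
  rw [h3]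
  exact h2.hadamard h1.map_exp

end PositiveDefinite

/-! ### The GNS construction -/

section GNS

open InnerProductSpace

open ComplexOrder in
/-- A positive definite kernel is the Gram matrix of a total family of vectors. -/
theorem Matrix.PosSemidef.exists_total_family.{u} {X : Type u} {k : Matrix X X ℂ}
    (hk : k.PosSemidef) :
    ∃ (H : Type u) (_ : NormedAddCommGroup H) (_ : InnerProductSpace ℂ H) (_ : CompleteSpace H)
      (ξ : X → H), (∀ x y, inner ℂ (ξ x) (ξ y) = k x y) ∧
        (Submodule.span ℂ (range ξ)).topologicalClosure = ⊤ := by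
  -- The scalar kernel is read as an operator-valued one on `ℂ`; the kernel functions at `1` form
  -- the total family.
  let K : Matrix X X (ℂ →L[ℂ] ℂ) := Matrix.of fun x y => k x y • ContinuousLinearMap.id ℂ ℂ
  have hherm : K.IsHermitian := by
    ext x y
    have h1 := hk.isHermitian.apply x y
    simp only [RCLike.star_def] at h1
    have h2 : star (ContinuousLinearMap.id ℂ ℂ) = ContinuousLinearMap.id ℂ ℂ := star_one _
    simp [K, Matrix.conjTranspose_apply, h1, h2]
  have hK : K.PosSemidef := by
    refine ((RKHS.posSemidef_tfae (K := K)).out 0 2).2 ?_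
    refine ⟨hherm, fun f => ?_⟩
    have h1 := (Complex.le_def.1 (hk.2 f)).1
    have h2 : (f.sum fun x w => f.sum fun x' w' => inner ℂ (K x' x w) w') =
        f.sum fun i xi => f.sum fun j xj => star xi * k i j * xj := by
      refine Finsupp.sum_congr fun x _ => Finsupp.sum_congr fun y _ => ?_
      have h1 := hk.isHermitian.apply x y
      simp only [RCLike.star_def] at h1
      simp [K, h1]
      ring
    rw [h2]
    simpa using h1
  have : Fact K.PosSemidef := ⟨hK⟩
  refine ⟨RKHS.OfKernel K, inferInstance, inferInstance, inferInstance,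
    fun x => RKHS.kerFun (RKHS.OfKernel K) x 1, fun x y => ?_, ?_⟩
  · rw [← RKHS.kernel_inner, RKHS.OfKernel.kernel_ofKernel]
    have h1 := hk.isHermitian.apply x y
    simp only [RCLike.star_def] at h1
    simp [K, h1]
  · rw [eq_top_iff, ← RKHS.kerFun_dense (H := RKHS.OfKernel K)]
    refine Submodule.topologicalClosure_mono (Submodule.span_le.2 ?_)
    rintro _ ⟨x, v, rfl⟩
    have : RKHS.kerFun (RKHS.OfKernel K) x v = v • RKHS.kerFun (RKHS.OfKernel K) x 1 := by
      rw [← map_smul, smul_eq_mul, mul_one]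
    rw [this]
    exact Submodule.smul_mem _ _ (Submodule.subset_span ⟨x, rfl⟩)

variable {G : Type*} [Group G] {H : Type*} [NormedAddCommGroup H] [InnerProductSpace ℂ H]

/-- A total family indexed by a group with a left invariant Gram matrix is an orbit of a unitary
representation. -/
theorem exists_unitary_rep_of_total_family [CompleteSpace H] (ξ : G → H)
    (hξ : (Submodule.span ℂ (range ξ)).topologicalClosure = ⊤)
    (hinv : ∀ x g h, inner ℂ (ξ (x * g)) (ξ (x * h)) = inner ℂ (ξ g) (ξ h)) :
    ∃ π : G →* (H ≃ₗᵢ[ℂ] H), ∀ g h, π g (ξ h) = ξ (g * h) := by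
  let e : (G →₀ ℂ) →ₗ[ℂ] H := Finsupp.linearCombination ℂ ξ
  have he : DenseRange e := by
    have h1 : (LinearMap.range e).topologicalClosure = ⊤ := by
      rw [Finsupp.range_linearCombination]; exact hξ
    exact Submodule.dense_iff_topologicalClosure_eq_top.2 h1
  -- The vectors `ξ g` may be linearly dependent. Preservation of `‖e f‖` makes translation of
  -- coefficients well defined on the image of `e`, and extendable to the closure.
  have hnorm : ∀ (x : G) (f : G →₀ ℂ),
      ‖e (Finsupp.domLCongr (R := ℂ) (Equiv.mulLeft x) f)‖ = ‖e f‖ := by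
    intro x f
    have : inner ℂ (e (Finsupp.domLCongr (R := ℂ) (Equiv.mulLeft x) f))
        (e (Finsupp.domLCongr (R := ℂ) (Equiv.mulLeft x) f)) = inner ℂ (e f) (e f) := by
      simp only [e, Finsupp.domLCongr_apply, Finsupp.domCongr_apply,
        Finsupp.linearCombination_equivMapDomain]
      simp only [Finsupp.linearCombination_apply, Finsupp.sum, sum_inner, inner_sum,
        inner_smul_left, inner_smul_right, Function.comp_apply, Equiv.coe_mulLeft, hinv]
    rw [← sq_eq_sq₀ (norm_nonneg _) (norm_nonneg _), ← inner_self_eq_norm_sq (𝕜 := ℂ),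
      ← inner_self_eq_norm_sq (𝕜 := ℂ), this]
  let T : G → (H ≃ₗᵢ[ℂ] H) := fun x =>
    (Finsupp.domLCongr (R := ℂ) (Equiv.mulLeft x)).extendOfIsometry e e he he (hnorm x)
  have hT : ∀ g h, T g (ξ h) = ξ (g * h) := by
    intro g h
    have h1 : e (Finsupp.single h 1) = ξ h := by simp [e]
    rw [← h1, LinearEquiv.extendOfIsometry_eq]
    simp [e]
  have hext : ∀ U V : H ≃ₗᵢ[ℂ] H, (∀ g, U (ξ g) = V (ξ g)) → U = V := by
    intro U V h
    ext v
    have hd : Dense (Submodule.span ℂ (range ξ) : Set H) :=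
      Submodule.dense_iff_topologicalClosure_eq_top.2 hξ
    have : (U.toContinuousLinearEquiv : H →L[ℂ] H) = V.toContinuousLinearEquiv := by
      refine ContinuousLinearMap.ext_on hd ?_
      rintro _ ⟨g, rfl⟩
      exact h g
    exact congrArg (fun L : H →L[ℂ] H => L v) this
  refine ⟨⟨⟨T, ?_⟩, ?_⟩, hT⟩
  · exact hext _ _ fun g => by rw [hT, one_mul]; rfl
  · intro x y
    refine hext _ _ fun g => ?_
    rw [hT, mul_assoc, ← hT, ← hT]
    rfl

end GNS

/-! ### Property (T) bounds cocycles -/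

section Delorme

open ComplexOrder

/-- For a group with property (T), every cocycle of a unitary representation, whose norm is
continuous, is bounded. -/
theorem HasPropertyT.exists_bound_of_cocycle {G : Type*} [Group G] [TopologicalSpace G]
    [IsTopologicalGroup G] (hT : HasPropertyT G)
    {E : Type*} [NormedAddCommGroup E] [InnerProductSpace ℂ E]
    (κ : G →* (E ≃ₗᵢ[ℂ] E)) (b : G → E) (hb : ∀ g h, b (g * h) = b g + κ g (b h))
    (hcont : Continuous fun g => ‖b g‖) : ∃ M, ∀ g, ‖b g‖ ≤ M := by
  by_contra! hunb
  obtain ⟨Q, hQ, ε, hε, hTQ⟩ := hT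
  obtain ⟨B, hB⟩ := (hQ.image hcont).bddAbove
  have hB' : ∀ g ∈ Q, ‖b g‖ ≤ B := fun g hg => hB ⟨g, hg, rfl⟩
  have hdiff : ∀ x g h, b (x * g) - b (x * h) = κ x (b g - b h) := by
    intro x g h
    rw [hb, hb, map_sub]; abel
  -- The scale `r` makes `ξ 1` a `(Q, ε)`-invariant vector, since `2 - 2 * exp (-t ^ 2) ≤ 2 * t ^ 2`
  -- with `t ≤ r * B` on `Q`.
  obtain ⟨r, hr, hrB⟩ : ∃ r : ℝ, 0 < r ∧ 2 * (r * B) ^ 2 < ε ^ 2 := by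
    refine ⟨ε / (2 * (|B| + 1)), by positivity, ?_⟩
    have h1 : (ε / (2 * (|B| + 1)) * B) ^ 2 ≤ (ε / 2) ^ 2 := by
      rw [sq_le_sq, abs_mul, abs_of_pos (by positivity : 0 < ε / (2 * (|B| + 1))),
        abs_of_pos (by positivity : 0 < ε / 2)]
      rw [div_mul_eq_mul_div, div_le_div_iff₀ (by positivity) (by positivity)]
      nlinarith [abs_nonneg B]
    nlinarith
  let k : Matrix G G ℂ :=
    Matrix.of fun g h => ((Real.exp (-‖r • b g - r • b h‖ ^ 2) : ℝ) : ℂ)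
  have hk : k.PosSemidef := posSemidef_exp_neg_norm_sub_sq fun g => r • b g
  have hkval : ∀ g h, k g h = ((Real.exp (-(r * ‖b g - b h‖) ^ 2) : ℝ) : ℂ) := by
    intro g h
    simp only [k, Matrix.of_apply]
    rw [← smul_sub, norm_smul, Real.norm_of_nonneg hr.le]
  have hkinv : ∀ x g h, k (x * g) (x * h) = k g h := by
    intro x g h
    rw [hkval, hkval, hdiff, LinearIsometryEquiv.norm_map]
  obtain ⟨H, _, _, _, ξ, hξ, htot⟩ := hk.exists_total_family
  obtain ⟨π, hπ⟩ := exists_unitary_rep_of_total_family ξ htot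
    (fun x g h => by rw [hξ, hξ, hkinv])
  have hdense : Dense (Submodule.span ℂ (range ξ) : Set H) :=
    Submodule.dense_iff_topologicalClosure_eq_top.2 htot
  have hb1 : b 1 = 0 := by simpa using hb 1 1
  have hξnorm : ∀ g, ‖ξ g‖ = 1 := by
    intro g
    have h1 := inner_self_eq_norm_sq (𝕜 := ℂ) (ξ g)
    rw [hξ, hkval] at h1
    have h2 : ‖ξ g‖ ^ 2 = 1 := by simpa using h1.symm
    exact (pow_eq_one_iff_of_nonneg (norm_nonneg _) two_ne_zero).1 h2
  have hξdist : ∀ g h, ‖ξ g - ξ h‖ ^ 2 = 2 - 2 * Real.exp (-(r * ‖b g - b h‖) ^ 2) := by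
    intro g h
    rw [norm_sub_sq (𝕜 := ℂ), hξ, hkval, hξnorm, hξnorm]
    simp only [RCLike.re_to_complex, Complex.ofReal_re]
    ring
  have hξcont : Continuous ξ := by
    rw [continuous_iff_continuousAt]
    intro g₀
    rw [ContinuousAt, tendsto_iff_norm_sub_tendsto_zero]
    have h1 : ∀ g, ‖ξ g - ξ g₀‖ = √(2 - 2 * Real.exp (-(r * ‖b (g₀⁻¹ * g)‖) ^ 2)) := by
      intro g
      rw [← Real.sqrt_sq (norm_nonneg (ξ g - ξ g₀)), hξdist]
      have := hdiff g₀ (g₀⁻¹ * g) 1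
      rw [mul_inv_cancel_left, mul_one, hb1, sub_zero] at this
      rw [this, LinearIsometryEquiv.norm_map]
    simp_rw [h1]
    have h2 : Continuous fun g => √(2 - 2 * Real.exp (-(r * ‖b (g₀⁻¹ * g)‖) ^ 2)) := by
      have := hcont.comp (continuous_const_mul g₀⁻¹)
      simp only [Function.comp_def] at this
      fun_prop
    have h3 := h2.tendsto g₀
    simpa [hb1] using h3
  have hstrong : IsStronglyContinuous π := by
    intro v
    refine hdense.induction (P := fun v => Continuous fun g => π g v) ?_ ?_ v
    · intro v hv
      induction hv using Submodule.span_induction with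
      | mem v hv =>
        obtain ⟨h, rfl⟩ := hv
        simp only [hπ]
        exact hξcont.comp (continuous_mul_const h)
      | zero => simpa using continuous_const
      | add v w _ _ hv hw => simp only [map_add]; exact hv.add hw
      | smul a v _ hv => simp only [map_smul]; exact hv.const_smul a
    · refine isClosed_of_closure_subset fun v hv => ?_
      refine continuous_of_uniform_approx_of_continuous fun u hu => ?_
      obtain ⟨δ, hδ, hδu⟩ := Metric.mem_uniformity_dist.1 hu
      obtain ⟨w, hw, hvw⟩ := Metric.mem_closure_iff.1 hv δ hδ
      refine ⟨fun g => π g w, hw, fun g => hδu ?_⟩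
      rwa [LinearIsometryEquiv.dist_map]
  obtain ⟨η, hη0, hη⟩ := hTQ H π hstrong ⟨ξ 1, by
    rw [← norm_ne_zero_iff, hξnorm]; exact one_ne_zero, fun g hg => by
    rw [hπ, mul_one, hξnorm, mul_one]
    refine lt_of_pow_lt_pow_left₀ 2 hε.le ?_
    rw [hξdist, hb1, sub_zero]
    have h1 := Real.add_one_le_exp (-(r * ‖b g‖) ^ 2)
    have h2 : (r * ‖b g‖) ^ 2 ≤ (r * B) ^ 2 := by
      have := hB' g hg
      gcongr
    linarith⟩
  -- An invariant `η` has constant inner product with the orbit `ξ`. As `‖b g‖ → ∞`, which happens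
  -- along `l` if `b` is unbounded, `ξ g` tends weakly to `0`. So `η` is orthogonal to a total
  -- family.
  have hconst : ∀ g, inner ℂ (ξ g) η = inner ℂ (ξ 1) η := by
    intro g
    conv_lhs => rw [← mul_one g, ← hπ, ← hη g, LinearIsometryEquiv.inner_map_map]
  let l : Filter G := comap (fun g => ‖b g‖) atTop
  have hl : l.NeBot := by
    rw [comap_neBot_iff]
    intro t ht
    obtain ⟨a, ha⟩ := mem_atTop_sets.1 ht
    obtain ⟨g, hg⟩ := hunb a
    exact ⟨g, ha _ hg.le⟩
  have hdecay : ∀ v : H, Tendsto (fun g => inner ℂ (ξ g) v) l (𝓝 0) := by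
    intro v
    refine hdense.induction (P := fun v => Tendsto (fun g => inner ℂ (ξ g) v) l (𝓝 0)) ?_ ?_ v
    · intro v hv
      induction hv using Submodule.span_induction with
      | mem v hv =>
        obtain ⟨h, rfl⟩ := hv
        simp only [hξ, hkval]
        rw [← Complex.ofReal_zero]
        refine (Complex.continuous_ofReal.tendsto 0).comp
          (Real.tendsto_exp_neg_atTop_nhds_zero.comp ?_)
        have h1 : Tendsto (fun g => ‖b g‖ - ‖b h‖) l atTop :=
          tendsto_atTop_add_const_right _ _ tendsto_comap
        have h2 : Tendsto (fun g => ‖b g - b h‖) l atTop :=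
          tendsto_atTop_mono (fun g => norm_sub_norm_le _ _) h1
        exact (tendsto_pow_atTop two_ne_zero).comp (h2.const_mul_atTop hr)
      | zero => simp
      | add v w _ _ hv hw => simpa only [inner_add_right, add_zero] using hv.add hw
      | smul a v _ hv => simpa only [inner_smul_right, mul_zero] using hv.const_mul a
    · refine isClosed_of_closure_subset fun v hv => ?_
      rw [mem_ofPred_eq, Metric.tendsto_nhds]
      intro δ hδ
      obtain ⟨w, hw, hvw⟩ := Metric.mem_closure_iff.1 hv (δ / 2) (half_pos hδ)
      filter_upwards [Metric.tendsto_nhds.1 hw (δ / 2) (half_pos hδ)] with g hg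
      rw [dist_zero_right] at hg ⊢
      have h1 : (inner ℂ (ξ g) v : ℂ) = inner ℂ (ξ g) (v - w) + inner ℂ (ξ g) w := by
        rw [inner_sub_right]; ring
      have h2 := norm_inner_le_norm (𝕜 := ℂ) (ξ g) (v - w)
      rw [hξnorm, one_mul, ← dist_eq_norm] at h2
      rw [h1]
      refine (norm_add_le _ _).trans_lt ?_
      linarith
  have hzero : inner ℂ (ξ 1) η = 0 := by
    have h1 := hdecay η
    simp only [hconst] at h1
    exact tendsto_nhds_unique tendsto_const_nhds h1
  apply hη0
  have hall : ∀ v : H, inner ℂ v η = 0 := by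
    intro v
    refine hdense.induction (P := fun v => inner ℂ v η = 0) ?_ ?_ v
    · intro v hv
      induction hv using Submodule.span_induction with
      | mem v hv =>
        obtain ⟨h, rfl⟩ := hv
        rw [hconst, hzero]
      | zero => simp
      | add v w _ _ hv hw => rw [inner_add_left, hv, hw, add_zero]
      | smul a v _ hv => rw [inner_smul_left, hv, mul_zero]
    · exact isClosed_eq (by fun_prop) continuous_const
  exact inner_self_eq_zero.1 (hall η)

end Delorme

/-! ### The Koopman representation of a relatively invariant measure -/

section RelativelyInvariant

variable {G X : Type*} [Group G] [MulAction G X] [MeasurableSpace X]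
  {μ : Measure X} {c : G →* ℝ}

theorem koopman_ae_eq [SigmaFinite μ] (hpos : ∀ g, 0 < c g)
    (hc : ∀ g, μ.map (fun x => g • x) = ENNReal.ofReal (c g) • μ) (g : G) (f : X → ℂ) :
    koopman μ g f =ᵐ[μ] fun x => (√(c g) : ℂ) * f (g⁻¹ • x) := by
  have h1 : (μ.map (fun y => g • y)).rnDeriv μ =ᵐ[μ] fun _ => ENNReal.ofReal (c g) := by
    rw [hc]
    filter_upwards [Measure.rnDeriv_smul_left_of_ne_top' μ μ (r := ENNReal.ofReal (c g))
      ENNReal.ofReal_ne_top, μ.rnDeriv_self] with x hx hx'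
    rw [hx, Pi.smul_apply, hx', smul_eq_mul, mul_one]
  filter_upwards [h1] with x hx
  rw [koopman, hx, ENNReal.toReal_ofReal (hpos g).le]

variable [MeasurableConstSMul G X]

theorem IsRelativelyInvariant.exists_character [SigmaFinite μ] (hμ0 : μ ≠ 0)
    (hμ : IsRelativelyInvariant G μ) :
    ∃ c : G →* ℝ, (∀ g, 0 < c g) ∧
      ∀ g, μ.map (fun x => g • x) = ENNReal.ofReal (c g) • μ := by
  choose c hc using hμ
  -- A set of finite nonzero mass makes the scaling constants unique, hence multiplicative.
  obtain ⟨A, hA0, hAtop⟩ : ∃ A, μ A ≠ 0 ∧ μ A ≠ ∞ := by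
    by_contra! h
    apply hμ0
    rw [← Measure.measure_univ_eq_zero, ← iUnion_spanningSets μ, measure_iUnion_null_iff]
    intro i
    by_contra hi
    exact (measure_spanningSets_lt_top μ i).ne (h _ hi)
  have hinj : ∀ a b : ℝ≥0, a • μ = b • μ → a = b := by
    intro a b hab
    have := congrArg (fun ν : Measure X => ν A) hab
    simp only [Measure.smul_apply, ENNReal.smul_def, smul_eq_mul] at this
    exact_mod_cast (ENNReal.mul_left_inj hA0 hAtop).1 this
  have hone : c 1 = 1 := by
    apply hinj
    rw [← hc 1, one_smul]
    simp
  have hmul : ∀ g h, c (g * h) = c g * c h := by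
    intro g h
    apply hinj
    rw [← hc (g * h), mul_comm, mul_smul, ← hc g, ← Measure.map_smul, ← hc h,
      Measure.map_map (measurable_const_smul g) (measurable_const_smul h)]
    simp only [Function.comp_def, mul_smul]
  refine ⟨⟨⟨fun g => c g, by simp [hone]⟩, fun g h => by simp [hmul]⟩, fun g => ?_, fun g => ?_⟩
  · have h1 : c g * c g⁻¹ = 1 := by rw [← hmul, mul_inv_cancel, hone]
    have h2 : c g ≠ 0 := left_ne_zero_of_mul_eq_one h1
    exact_mod_cast pos_iff_ne_zero.2 h2
  · rw [hc]
    simp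

theorem quasiMeasurePreserving_smul_of_map_eq
    (hc : ∀ g, μ.map (fun x => g • x) = ENNReal.ofReal (c g) • μ) (g : G) :
    Measure.QuasiMeasurePreserving (fun x : X => g • x) μ μ := by
  refine ⟨measurable_const_smul g, ?_⟩
  rw [hc]
  exact Measure.smul_absolutelyContinuous

/-- The change of variables multiplies the measure by `c g⁻¹`, and the square root of this factor
cancels `√(c g)`. -/
theorem eLpNorm_smul_comp (hpos : ∀ g, 0 < c g)
    (hc : ∀ g, μ.map (fun x => g • x) = ENNReal.ofReal (c g) • μ) (g : G)
    {f : X → ℂ} (hf : AEStronglyMeasurable f μ) :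
    eLpNorm (fun x => (√(c g) : ℂ) * f (g⁻¹ • x)) 2 μ = eLpNorm f 2 μ := by
  have h1 : eLpNorm (fun x => f (g⁻¹ • x)) 2 μ = eLpNorm f 2 (μ.map fun x => g⁻¹ • x) := by
    refine (eLpNorm_map_measure ?_ (measurable_const_smul _).aemeasurable).symm
    rw [hc]
    exact hf.smul_measure _
  have h2 : (fun x => (√(c g) : ℂ) * f (g⁻¹ • x)) = (√(c g) : ℂ) • fun x => f (g⁻¹ • x) := rfl
  rw [h2, eLpNorm_const_smul, h1, hc, eLpNorm_smul_measure_of_ne_top (by simp), smul_eq_mul,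
    ← mul_assoc]
  have h3 : c g⁻¹ = (c g)⁻¹ := by
    exact eq_inv_of_mul_eq_one_left (by rw [← map_mul, inv_mul_cancel, map_one])
  have h4 : ‖(√(c g) : ℂ)‖ₑ = ENNReal.ofReal √(c g) := by
    rw [← ofReal_norm, Complex.norm_real, Real.norm_of_nonneg (Real.sqrt_nonneg _)]
  have h5 : ENNReal.ofReal (c g⁻¹) ^ (1 / (2 : ℝ≥0∞)).toReal = ENNReal.ofReal (√(c g))⁻¹ := by
    rw [ENNReal.ofReal_rpow_of_pos (hpos _), h3, ← Real.sqrt_inv, Real.sqrt_eq_rpow]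
    norm_num
  rw [h4, h5, ← ENNReal.ofReal_mul (Real.sqrt_nonneg _),
    mul_inv_cancel₀ (Real.sqrt_pos.2 (hpos g)).ne',
    ENNReal.ofReal_one, one_mul]

theorem memLp_smul_comp (hpos : ∀ g, 0 < c g)
    (hc : ∀ g, μ.map (fun x => g • x) = ENNReal.ofReal (c g) • μ) (g : G)
    {f : X → ℂ} (hf : MemLp f 2 μ) :
    MemLp (fun x => (√(c g) : ℂ) * f (g⁻¹ • x)) 2 μ := by
  refine ⟨?_, ?_⟩
  · exact (hf.1.comp_quasiMeasurePreserving
      (quasiMeasurePreserving_smul_of_map_eq hc g⁻¹)).const_mul _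
  · rw [eLpNorm_smul_comp hpos hc g hf.1]
    exact hf.2

/-- The Koopman representation as a unitary representation on `L²`. -/
theorem exists_koopman_rep (hpos : ∀ g, 0 < c g)
    (hc : ∀ g, μ.map (fun x => g • x) = ENNReal.ofReal (c g) • μ) :
    ∃ κ : G →* (Lp ℂ 2 μ ≃ₗᵢ[ℂ] Lp ℂ 2 μ),
    ∀ g (f : Lp ℂ 2 μ), κ g f =ᵐ[μ] fun x => (√(c g) : ℂ) * f (g⁻¹ • x) := by
  let T : G → Lp ℂ 2 μ → Lp ℂ 2 μ := fun g f => (memLp_smul_comp hpos hc g (Lp.memLp f)).toLp _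
  have hT : ∀ g f, T g f =ᵐ[μ] fun x => (√(c g) : ℂ) * f (g⁻¹ • x) := fun g f => MemLp.coeFn_toLp _
  have hq := fun g : G => quasiMeasurePreserving_smul_of_map_eq hc g
  have hadd : ∀ g f f', T g (f + f') = T g f + T g f' := by
    intro g f f'
    refine Lp.ext ?_
    filter_upwards [hT g (f + f'), hT g f, hT g f', Lp.coeFn_add (T g f) (T g f'),
      (hq g⁻¹).ae (Lp.coeFn_add f f')] with x h1 h2 h3 h4 h5
    rw [h1, h4, Pi.add_apply, h2, h3, h5, Pi.add_apply, mul_add]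
  have hsmul : ∀ g (a : ℂ) f, T g (a • f) = a • T g f := by
    intro g a f
    refine Lp.ext ?_
    filter_upwards [hT g (a • f), hT g f, Lp.coeFn_smul a (T g f),
      (hq g⁻¹).ae (Lp.coeFn_smul a f)] with x h1 h2 h4 h5
    rw [h1, h4, Pi.smul_apply, h2, h5, Pi.smul_apply, smul_eq_mul, smul_eq_mul]
    ring
  have hmul : ∀ g h f, T (g * h) f = T g (T h f) := by
    intro g h f
    refine Lp.ext ?_
    filter_upwards [hT (g * h) f, hT g (T h f), (hq g⁻¹).ae (hT h f)] with x h1 h2 h3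
    rw [h1, h2, h3, map_mul, Real.sqrt_mul (hpos g).le, mul_inv_rev, mul_smul, Complex.ofReal_mul,
      mul_assoc]
  have hone : ∀ f, T 1 f = f := by
    intro f
    refine Lp.ext ?_
    filter_upwards [hT 1 f] with x h1
    rw [h1]; simp
  have hnorm : ∀ g f, ‖T g f‖ = ‖f‖ := by
    intro g f
    rw [Lp.norm_def, Lp.norm_def, eLpNorm_congr_ae (hT g f),
      eLpNorm_smul_comp hpos hc g (Lp.aestronglyMeasurable f)]
  let U : G → (Lp ℂ 2 μ ≃ₗᵢ[ℂ] Lp ℂ 2 μ) := fun g =>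
    { toFun := T g
      invFun := T g⁻¹
      map_add' := hadd g
      map_smul' := hsmul g
      left_inv := fun f => by rw [← hmul, inv_mul_cancel, hone]
      right_inv := fun f => by rw [← hmul, mul_inv_cancel, hone]
      norm_map' := hnorm g }
  refine ⟨⟨⟨U, ?_⟩, ?_⟩, hT⟩
  · ext1 f; exact hone f
  · intro g h; ext1 f; exact hmul g h f

end RelativelyInvariant

/-! ### Ergodicity of transitive actions -/

section Ergodic

variable {G X : Type*} [Group G] [TopologicalSpace G] [IsTopologicalGroup G]
  [LocallyCompactSpace G] [SecondCountableTopology G]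
  [TopologicalSpace X] [SecondCountableTopology X] [MulAction G X] [ContinuousSMul G X]
  [MulAction.IsPretransitive G X] [MeasurableSpace X] [BorelSpace X] {μ : Measure X} [SFinite μ]

/-- A transitive action of a locally compact group is ergodic. -/
theorem ae_eq_const_of_forall_smul_ae_eq
    (hq : ∀ g : G, Measure.QuasiMeasurePreserving (fun x : X => g • x) μ μ) (hμ0 : μ ≠ 0)
    {u : X → ℂ} (hum : AEMeasurable u μ) (hu : ∀ g : G, ∀ᵐ x ∂μ, u (g⁻¹ • x) = u x) :
    ∃ a, ∀ᵐ x ∂μ, u x = a := by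
  borelize G
  wlog hmeas : Measurable u generalizing u
  · obtain ⟨a, ha⟩ := this (u := hum.mk u) hum.measurable_mk.aemeasurable (fun g => by
      filter_upwards [hu g, hum.ae_eq_mk, (hq g⁻¹).ae hum.ae_eq_mk] with x h1 h2 h3
      rw [← h2, ← h3, h1]) hum.measurable_mk
    refine ⟨a, ?_⟩
    filter_upwards [ha, hum.ae_eq_mk] with x h1 h2
    rw [h2, h1]
  let m : Measure G := Measure.haar
  have : (ae μ).NeBot := ae_neBot.2 hμ0
  have hact : Measurable fun p : G × X => p.1⁻¹ • p.2 :=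
    (continuous_fst.inv.smul continuous_snd).measurable
  -- Fubini yields one point `x₀` along whose orbit `u` is constant for almost every `g`. Left
  -- invariance of Haar measure moves this to every point, and a second use of Fubini returns to
  -- `μ`.
  have h1 : ∀ᵐ x ∂μ, ∀ᵐ g ∂m, u (g⁻¹ • x) = u x := by
    rw [← Measure.ae_ae_comm]
    · exact Eventually.of_forall hu
    · exact measurableSet_eq_fun (hmeas.comp hact) (hmeas.comp measurable_snd)
  obtain ⟨x₀, hx₀⟩ := h1.exists
  have h2 : ∀ x : X, ∀ᵐ g ∂m, u (g⁻¹ • x) = u x₀ := by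
    intro x
    obtain ⟨h, rfl⟩ := MulAction.exists_smul_eq G x₀ x
    have := (measurePreserving_mul_left m h⁻¹).quasiMeasurePreserving.ae hx₀
    simpa [mul_smul] using this
  have h3 : ∀ᵐ g ∂m, ∀ᵐ x ∂μ, u (g⁻¹ • x) = u x₀ := by
    rw [Measure.ae_ae_comm]
    · exact Eventually.of_forall h2
    · exact measurableSet_eq_fun (hmeas.comp hact) measurable_const
  obtain ⟨g, hg⟩ := h3.exists
  refine ⟨u x₀, ?_⟩
  simpa using (hq g).ae hg

end Ergodic

/-! ### Almost invariant cutoff functions -/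

section Cutoff

variable {X : Type*} [TopologicalSpace X]

/-- A set with compact frontier has a continuous indicator function up to a compact set. -/
theorem exists_continuous_eq_indicator_off_compact [T2Space X] [LocallyCompactSpace X]
    {D K : Set X} (hK : IsCompact K)
    (hD : frontier D ⊆ K) :
    ∃ (E : X → ℝ) (M : Set X), Continuous E ∧ IsCompact M ∧ frontier D ⊆ M ∧
      (∀ x ∈ D, x ∉ M → E x = 1) ∧ ∀ x ∉ D, E x = 0 := by
  obtain ⟨χ, hχ1, -, hχc, -⟩ :=
    exists_continuous_one_zero_of_isCompact hK isClosed_empty (disjoint_empty K)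
  -- The factor `1 - χ` vanishes on `K`, hence on `frontier D`, which makes the indicator
  -- continuous.
  refine ⟨D.indicator fun x => 1 - χ x, tsupport χ ∪ K, ?_, hχc.isCompact.union hK,
    hD.trans subset_union_right, fun x hx hxM => ?_, fun x hx => indicator_of_notMem hx _⟩
  · refine continuous_indicator (fun x hx => ?_) (by fun_prop)
    have := hχ1 (hD hx)
    simp at this
    rw [this, sub_self]
  · rw [indicator_of_mem hx, image_eq_zero_of_notMem_tsupport fun h => hxM (Or.inl h), sub_zero]

variable {G : Type*} [Group G] [TopologicalSpace G] [ContinuousInv G] [MulAction G X]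
  [ContinuousSMul G X]

/-- For `x ∉ L • M` the connected set of all `l⁻¹ • x` avoids `M`, hence `frontier D`; it stays on
one side of `D`, where `E` is constant off `M`. -/
theorem smul_eq_of_notMem_smul_of_isPreconnected {E : X → ℝ} {D M : Set X} {L : Set G}
    (hL : IsPreconnected L) (hDM : frontier D ⊆ M) (h1 : ∀ x ∈ D, x ∉ M → E x = 1)
    (h0 : ∀ x ∉ D, E x = 0) {g h : G} (hg : g ∈ L) (hh : h ∈ L) {x : X} (hx : x ∉ L • M) :
    E (g⁻¹ • x) = E (h⁻¹ • x) := by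
  have hM : ∀ l ∈ L, l⁻¹ • x ∉ M := fun l hl hlM => hx ⟨l, hl, _, hlM, smul_inv_smul l x⟩
  have hpre : IsPreconnected ((fun l : G => l⁻¹ • x) '' L) :=
    hL.image _ (by fun_prop)
  rcases hpre.subset_or_subset_compl_of_disjoint_frontier (D := D) (by
    rintro _ ⟨l, hl, rfl⟩ hf
    exact hM l hl (hDM hf)) with h | h
  · rw [h1 _ (h ⟨g, hg, rfl⟩) (hM g hg), h1 _ (h ⟨_, hh, rfl⟩) (hM _ hh)]
  · rw [h0 _ (h ⟨g, hg, rfl⟩), h0 _ (h ⟨_, hh, rfl⟩)]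

end Cutoff

/-! ### From vanishing cohomology to one infinite volume end -/

section Dichotomy

theorem L2_norm_toLp_eq_sqrt {X : Type*} [MeasurableSpace X] {μ : Measure X} {f : X → ℂ} (hf : MemLp f 2 μ) :
    ‖hf.toLp f‖ = √(∫ x, ‖f x‖ ^ 2 ∂μ) := by
  rw [Lp.norm_toLp, hf.eLpNorm_eq_integral_rpow_norm two_ne_zero ENNReal.ofNat_ne_top,
    ENNReal.toReal_ofReal (by positivity), Real.sqrt_eq_rpow]
  norm_num

variable {G X : Type*} [Group G] [TopologicalSpace G] [IsTopologicalGroup G] [T2Space G]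
  [LocallyCompactSpace G] [SecondCountableTopology G] [PathConnectedSpace G]
  [TopologicalSpace X] [T2Space X] [LocallyCompactSpace X] [SecondCountableTopology X]
  [MulAction G X] [ContinuousSMul G X] [MulAction.IsPretransitive G X]
  [MeasurableSpace X] [BorelSpace X] {μ : Measure X} [IsLocallyFiniteMeasure μ]

/-- The cohomological dichotomy: if all cocycles of `s • κ` are coboundaries, then a set with
compact frontier or its complement has finite measure with respect to the density `w²`, where `w`
is a positive function invariant under `s • κ`. -/
theorem withDensity_lt_top_or_compl_lt_top (hμ0 : μ ≠ 0) {c : G →* ℝ}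
    (hc : ∀ g, μ.map (fun x => g • x) = ENNReal.ofReal (c g) • μ)
    {κ : G →* (Lp ℂ 2 μ ≃ₗᵢ[ℂ] Lp ℂ 2 μ)}
    (hκ : ∀ g (f : Lp ℂ 2 μ), κ g f =ᵐ[μ] fun x => (√(c g) : ℂ) * f (g⁻¹ • x))
    {s : G →* ℝ} {w : X → ℝ} (hw : Continuous w) (hw0 : ∀ x, 0 < w x)
    (hsw : ∀ g x, s g * √(c g) * w (g⁻¹ • x) = w x)
    (hcob : ∀ b : G → Lp ℂ 2 μ, (∀ g h, b (g * h) = b g + s g • κ g (b h)) →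
      Continuous (fun g => ‖b g‖) → ∃ v, ∀ g, s g • κ g v + b g = v)
    {D K : Set X} (hDm : MeasurableSet D) (hK : IsCompact K) (hD : frontier D ⊆ K) :
    μ.withDensity (fun x => ENNReal.ofReal (w x ^ 2)) D < ∞ ∨
      μ.withDensity (fun x => ENNReal.ofReal (w x ^ 2)) Dᶜ < ∞ := by
  have : LocallyConnectedSpace G := .of_pathConnected_group
  have hq : ∀ g : G, Measure.QuasiMeasurePreserving (fun x : X => g • x) μ μ :=
    fun g => quasiMeasurePreserving_smul_of_map_eq hc g
  obtain ⟨E, M, hE, hM, hDM, hE1, hE0⟩ := exists_continuous_eq_indicator_off_compact hK hD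
  -- Formally this is the coboundary `s g • κ g (w * E) - w * E`, but `w * E` need not be square
  -- integrable.
  let β : G → X → ℂ := fun g x => ((w x * (E (g⁻¹ • x) - E x) : ℝ) : ℂ)
  have hβcont : Continuous fun p : G × X => β p.1 p.2 := by
    refine Complex.continuous_ofReal.comp ?_
    have h1 : Continuous fun p : G × X => p.1⁻¹ • p.2 := continuous_fst.inv.smul continuous_snd
    exact (hw.comp continuous_snd).mul ((hE.comp h1).sub (hE.comp continuous_snd))
  have hβ0 : ∀ {L : Set G}, IsPreconnected L → (1 : G) ∈ L → ∀ g ∈ L, ∀ x ∉ L • M, β g x = 0 := by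
    intro L hL h1 g hg x hx
    have := smul_eq_of_notMem_smul_of_isPreconnected hL hDM hE1 hE0 hg h1 hx
    simp only [inv_one, one_smul] at this
    simp [β, this]
  have hβmem : ∀ g, MemLp (β g) 2 μ := by
    intro g
    obtain ⟨L, hLc, hLp, h1, hgL⟩ :=
      (isCompact_singleton (x := g)).exists_isCompact_isPreconnected_superset 1
    refine (hβcont.comp (Continuous.prodMk_right g)).memLp_of_hasCompactSupport ?_
    exact HasCompactSupport.intro (hLc.smul_set hM) fun x hx =>
      hβ0 hLp h1 g (hgL rfl) x hx
  let b : G → Lp ℂ 2 μ := fun g => (hβmem g).toLp (β g)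
  have hb : ∀ g, b g =ᵐ[μ] β g := fun g => MemLp.coeFn_toLp _
  have hbmul : ∀ g h, b (g * h) = b g + s g • κ g (b h) := by
    intro g h
    refine Lp.ext ?_
    filter_upwards [hb (g * h), hb g, hκ g (b h), (hq g⁻¹).ae (hb h),
      Lp.coeFn_add (b g) (s g • κ g (b h)), Lp.coeFn_smul (s g) (κ g (b h))] with
      x h1 h2 h3 h4 h5 h6
    rw [h1, h5, Pi.add_apply, h6, Pi.smul_apply, h2, h3, h4]
    simp only [β, Complex.real_smul, ← Complex.ofReal_mul, ← Complex.ofReal_add]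
    congr 1
    rw [← hsw g x, mul_inv_rev, mul_smul]
    ring
  have hbcont : Continuous fun g => ‖b g‖ := by
    rw [continuous_iff_continuousAt]
    intro g₀
    obtain ⟨N, hNc, hN⟩ := exists_compact_mem_nhds g₀
    obtain ⟨L, hLc, hLp, h1, hNL⟩ := hNc.exists_isCompact_isPreconnected_superset 1
    have h2 : ContinuousOn (fun g => ∫ x, ‖β g x‖ ^ 2 ∂μ) L := by
      refine continuousOn_integral_of_compact_support (hLc.smul_set hM) ?_ ?_
      · exact (hβcont.norm.pow 2).continuousOn
      · intro g x hg hx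
        rw [hβ0 hLp h1 g hg x hx]
        simp
    have h3 := (h2.sqrt).continuousAt (mem_of_superset hN hNL)
    simpa only [b, L2_norm_toLp_eq_sqrt] using h3
  obtain ⟨v, hv⟩ := hcob b hbmul hbcont
  -- This is the coboundary equation divided by `w`.
  have hinv : ∀ g : G, ∀ᵐ x ∂μ, v (g⁻¹ • x) / w (g⁻¹ • x) + E (g⁻¹ • x) = v x / w x + E x := by
    intro g
    have h0 : (s g • κ g v + b g : Lp ℂ 2 μ) =ᵐ[μ] v := by rw [hv g]
    filter_upwards [h0, hb g, hκ g v, Lp.coeFn_add (s g • κ g v) (b g),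
      Lp.coeFn_smul (s g) (κ g v)] with x h1 h2 h3 h4 h5
    rw [h4, Pi.add_apply, h5, Pi.smul_apply, h2, h3] at h1
    have hx : (w x : ℂ) ≠ 0 := by exact_mod_cast (hw0 x).ne'
    have hgx : (w (g⁻¹ • x) : ℂ) ≠ 0 := by exact_mod_cast (hw0 _).ne'
    have hs : (w x : ℂ) = s g * √(c g) * w (g⁻¹ • x) := by
      rw [← hsw g x]; push_cast; ring
    have hsc : ((s g : ℂ) * √(c g)) ≠ 0 := left_ne_zero_of_mul (hs ▸ hx)
    have hs0 := left_ne_zero_of_mul hsc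
    have hc0 := right_ne_zero_of_mul hsc
    rw [← h1]
    simp only [β, Complex.real_smul]
    push_cast
    rw [hs]
    field_simp
    ring
  obtain ⟨a, ha⟩ := ae_eq_const_of_forall_smul_ae_eq hq hμ0
    (u := fun x => v x / w x + E x) (by
      have h1 := (Lp.aestronglyMeasurable v).aemeasurable
      have h2 : AEMeasurable (fun x => (w x : ℂ)) μ :=
        (Complex.continuous_ofReal.comp hw).measurable.aemeasurable
      have h3 : AEMeasurable (fun x => (E x : ℂ)) μ :=
        (Complex.continuous_ofReal.comp hE).measurable.aemeasurable
      exact (h1.div h2).add h3) hinv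
  have hva : ∀ᵐ x ∂μ, v x = w x * (a - E x) := by
    filter_upwards [ha] with x hx
    have hx' : (w x : ℂ) ≠ 0 := by exact_mod_cast (hw0 x).ne'
    rw [← hx]
    field_simp
    ring
  have hvfin : ∫⁻ x, ‖v x‖ₑ ^ 2 ∂μ < ∞ := by
    have h1 := (Lp.memLp v).2
    rw [eLpNorm_lt_top_iff_lintegral_rpow_enorm_lt_top two_ne_zero ENNReal.ofNat_ne_top] at h1
    simpa using h1
  have hfin : ∀ (A : Set X) (e : ℂ), MeasurableSet A → a ≠ e → (∀ x ∈ A, (E x : ℂ) = e) →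
      μ.withDensity (fun x => ENNReal.ofReal (w x ^ 2)) A < ∞ := by
    intro A e hA hae hAe
    have hne : ‖a - e‖ₑ ^ 2 ≠ 0 := by simpa [sub_eq_zero] using hae
    rw [withDensity_apply _ hA]
    have h1 : ‖a - e‖ₑ ^ 2 * ∫⁻ x in A, ENNReal.ofReal (w x ^ 2) ∂μ < ∞ := by
      rw [← lintegral_const_mul _ (by fun_prop)]
      refine lt_of_le_of_lt ?_ hvfin
      refine le_trans ?_ (setLIntegral_le_lintegral A _)
      refine lintegral_mono_ae ?_
      filter_upwards [ae_restrict_mem hA, ae_restrict_of_ae hva] with x hx hvx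
      rw [hvx, hAe x hx, enorm_mul, mul_pow, mul_comm]
      gcongr
      rw [← ofReal_norm, Complex.norm_real, Real.norm_of_nonneg (hw0 x).le,
        ENNReal.ofReal_pow (hw0 x).le]
    exact (ENNReal.mul_lt_top_iff.1 h1).elim (fun h => h.2) fun h => by
      rcases h with h | h
      · exact absurd h hne
      · rw [h]; exact ENNReal.zero_lt_top
  -- The constant `a` cannot be both `0` and `1`: `a ≠ 0` bounds `Dᶜ`, where `E = 0`, and `a ≠ 1`
  -- bounds `D \ M`, where `E = 1`.
  by_cases ha1 : a = 1
  · right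
    refine hfin Dᶜ 0 hDm.compl (by rw [ha1]; exact one_ne_zero) fun x hx => ?_
    rw [hE0 x hx, Complex.ofReal_zero]
  · left
    have := IsLocallyFiniteMeasure.withDensity_ofReal (μ := μ) (hw.pow 2)
    refine (measure_mono (t := (D \ M) ∪ M) fun x hx => ?_).trans_lt
      ((measure_union_le _ _).trans_lt (ENNReal.add_lt_top.2 ⟨?_, hM.measure_lt_top⟩))
    · by_cases hxM : x ∈ M
      · exact Or.inr hxM
      · exact Or.inl ⟨hx, hxM⟩
    · refine hfin _ 1 (hDm.diff hM.measurableSet) ha1 fun x hx => ?_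
      rw [hE1 x hx.1 hx.2, Complex.ofReal_one]

/-- If every set with compact frontier has finite or cofinite measure, and the total measure is
infinite, then there is exactly one infinite volume end. -/
theorem hasExactlyOneInfiniteVolumeEnd_of_dichotomy {X : Type*} [TopologicalSpace X] [T2Space X]
    [LocallyCompactSpace X] [LocallyConnectedSpace X] [ConnectedSpace X]
    [MeasurableSpace X] [BorelSpace X] (ν : Measure X) [IsFiniteMeasureOnCompacts ν]
    (hν : ν univ = ∞) (h : ∀ D K : Set X, MeasurableSet D → IsCompact K → frontier D ⊆ K →
      ν D < ∞ ∨ ν Dᶜ < ∞) : HasExactlyOneInfiniteVolumeEnd ν := by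
  intro K hK
  obtain ⟨C, hC, hCν⟩ := exists_isComponentOf_compl_measure_eq_top ν hν hK
  refine ⟨C, ⟨hC, hCν⟩, fun C' ⟨hC', hC'ν⟩ => ?_⟩
  by_contra hne
  have hdisj : C' ⊆ Cᶜ := fun x hx' hx =>
    hne ((hC'.eq_connectedComponentIn hx').trans (hC.eq_connectedComponentIn hx).symm)
  rcases h C K (hC.isOpen hK.isClosed.isOpen_compl).measurableSet hK
    (hC.frontier_subset hK.isClosed) with h | h
  · exact h.ne hCν
  · exact ((measure_mono hdisj).trans_lt h).ne hC'ν

end Dichotomy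

/-! ### Continuity and triviality of the modular factor -/

section Character

variable {G X : Type*} [Group G] [TopologicalSpace G] [IsTopologicalGroup G]

/-- For a bump function `f`, `c g` is the ratio of `∫ f (g • x)` to `∫ f x`, and the supports stay
in one compact set for `g` near a given point. -/
theorem continuous_character_of_map_smul_eq [LocallyCompactSpace G]
    [TopologicalSpace X] [T2Space X] [LocallyCompactSpace X] [SecondCountableTopology X]
    [MulAction G X] [ContinuousSMul G X] [MeasurableSpace X] [BorelSpace X] {μ : Measure X}
    [IsLocallyFiniteMeasure μ] (hμ0 : μ ≠ 0) {c : G →* ℝ} (hpos : ∀ g, 0 < c g)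
    (hc : ∀ g, μ.map (fun x => g • x) = ENNReal.ofReal (c g) • μ) : Continuous c := by
  obtain ⟨K, hK, hμK⟩ : ∃ K : Set X, IsCompact K ∧ μ K ≠ 0 := by
    by_contra! h
    apply hμ0
    rw [← Measure.measure_univ_eq_zero, ← iUnion_compactCovering X, measure_iUnion_null_iff]
    exact fun i => h _ (isCompact_compactCovering X i)
  obtain ⟨f, hf1, -, hfc, hf01⟩ :=
    exists_continuous_one_zero_of_isCompact hK isClosed_empty (disjoint_empty K)
  have hfint : 0 < ∫ x, f x ∂μ := by
    have hfi : Integrable f μ := f.continuous.integrable_of_hasCompactSupport hfc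
    have h1 : ∫ x in K, f x ∂μ ≤ ∫ x, f x ∂μ :=
      setIntegral_le_integral hfi (Eventually.of_forall fun x => (hf01 x).1)
    have h2 : ∫ x in K, f x ∂μ = μ.real K := by
      rw [setIntegral_congr_fun hK.measurableSet hf1]
      simp
    have h3 : 0 < μ.real K := ENNReal.toReal_pos hμK hK.measure_lt_top.ne
    linarith
  have hcf : ∀ g, c g = (∫ x, f (g • x) ∂μ) / ∫ x, f x ∂μ := by
    intro g
    have h1 : ∫ x, f x ∂(μ.map fun x => g • x) = ∫ x, f (g • x) ∂μ :=
      integral_map (measurable_const_smul g).aemeasurable f.continuous.aestronglyMeasurable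
    rw [hc, integral_smul_measure, ENNReal.toReal_ofReal (hpos g).le, smul_eq_mul] at h1
    rw [eq_div_iff hfint.ne', h1]
  have hcont : Continuous fun g : G => ∫ x, f (g • x) ∂μ := by
    rw [continuous_iff_continuousAt]
    intro g₀
    obtain ⟨N, hNc, hN⟩ := exists_compact_mem_nhds g₀
    refine (continuousOn_integral_of_compact_support (s := N) (f := fun (g : G) x => f (g • x))
      (hNc.inv.smul_set hfc.isCompact) ?_ ?_).continuousAt hN
    · exact (f.continuous.comp continuous_smul).continuousOn
    · intro g x hg hx
      refine image_eq_zero_of_notMem_tsupport fun h => hx ?_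
      exact ⟨g⁻¹, inv_mem_inv.2 hg, _, h, inv_smul_smul g x⟩
  have : (c : G → ℝ) = fun g : G => (∫ x, f (g • x) ∂μ) / ∫ x, f x ∂μ := funext hcf
  rw [this]
  exact hcont.div_const _

/-- A group with property (T) has no nontrivial continuous characters into the positive reals. -/
theorem HasPropertyT.character_eq_one (hT : HasPropertyT G) {c : G →* ℝ} (hpos : ∀ g, 0 < c g)
    (hcont : Continuous c) (g : G) : c g = 1 := by
  -- `log c` is a cocycle of the trivial representation on `ℂ`, and a bounded homomorphism to the
  -- reals is zero.
  obtain ⟨M, hM⟩ := hT.exists_bound_of_cocycle (1 : G →* (ℂ ≃ₗᵢ[ℂ] ℂ))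
    (fun g => (Real.log (c g) : ℂ)) (fun g h => by
      rw [map_mul, Real.log_mul (hpos g).ne' (hpos h).ne']
      push_cast
      rfl) (by
      simp only [Complex.norm_real]
      exact (hcont.log fun g => (hpos g).ne').norm)
  have h1 : ∀ n : ℕ, n * |Real.log (c g)| ≤ M := by
    intro n
    have := hM (g ^ n)
    rw [map_pow, Real.log_pow, Complex.norm_real, Real.norm_eq_abs, abs_mul, Nat.abs_cast] at this
    exact this
  have h2 : Real.log (c g) = 0 := by
    by_contra hne
    obtain ⟨n, hn⟩ := exists_nat_gt (M / |Real.log (c g)|)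
    rw [div_lt_iff₀ (abs_pos.2 hne)] at hn
    exact absurd (h1 n) (not_le.2 hn)
  rcases Real.log_eq_zero.1 h2 with h | h | h
  · exact absurd h (hpos g).ne'
  · exact h
  · linarith [hpos g]

end Character

/-! ### Vanishing of cocycles of the Koopman representation -/

section Coboundary

variable {G X : Type*} [Group G] [TopologicalSpace G] [MulAction G X] [MeasurableSpace X]
  {μ : Measure X} {c : G →* ℝ} {κ : G →* (Lp ℂ 2 μ ≃ₗᵢ[ℂ] Lp ℂ 2 μ)}

/-- The failure of almost invariance is a spectral gap on a compact `Q ⊆ S i`, and continuity of `‖b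
g‖` bounds the cocycle there. -/
theorem exists_fixedPoint_of_isGeneratedByCommutingChain [SigmaFinite μ]
    (hpos : ∀ g, 0 < c g) (hc : ∀ g, μ.map (fun x => g • x) = ENNReal.ofReal (c g) • μ)
    (hκ : ∀ g (f : Lp ℂ 2 μ), κ g f =ᵐ[μ] fun x => (√(c g) : ℂ) * f (g⁻¹ • x))
    {S : ℕ → Subgroup G} (hS : (⨆ n, S n) = ⊤)
    (hcomm : ∀ n, ∀ g ∈ S n, ∀ h ∈ S (n + 1), g * h = h * g)
    (hinv : ∀ n, ¬ KoopmanHasInvariantVector μ (S n))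
    {i : ℕ} (hai : ¬ KoopmanHasAlmostInvariantVectors μ (S i))
    {s : G →* ℝ} (hs : ∀ g, 0 < s g) (b : G → Lp ℂ 2 μ)
    (hb : ∀ g h, b (g * h) = b g + s g • κ g (b h)) (hbc : Continuous fun g => ‖b g‖) :
    ∃ v, ∀ g, s g • κ g v + b g = v := by
  have hkoop : ∀ g (f : Lp ℂ 2 μ), koopman μ g f =ᵐ[μ] κ g f := fun g f =>
    (koopman_ae_eq hpos hc g f).trans (hκ g f).symm
  simp only [KoopmanHasAlmostInvariantVectors, not_forall, not_exists, not_and] at hai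
  obtain ⟨Q, hQS, hQ, ε, hε, hgap⟩ := hai
  obtain ⟨M, hM⟩ := (hQ.image hbc).bddAbove
  refine exists_fixedPoint_of_commuting_chain κ s hs b hb S hS hcomm ?_ hQS hε (fun v hv => ?_)
    (M := M) fun h hh => hM ⟨h, hh, rfl⟩
  · intro n v hv
    by_contra hne
    exact hinv n ⟨v, hne, fun h hh => (hkoop h v).trans (by rw [hv h hh])⟩
  · obtain ⟨h, hh, hlt⟩ := hgap v hv
    refine ⟨h, hh, ?_⟩
    have h1 : eLpNorm (koopman μ h v - ⇑v) 2 μ = ENNReal.ofReal ‖κ h v - v‖ := by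
      rw [Lp.norm_def, ENNReal.ofReal_toReal (Lp.eLpNorm_ne_top _)]
      exact eLpNorm_congr_ae (((hkoop h v).sub EventuallyEq.rfl).trans
        (Lp.coeFn_sub (κ h v) v).symm)
    rw [h1, not_lt] at hlt
    exact (ENNReal.ofReal_le_ofReal_iff (norm_nonneg _)).1 hlt

theorem HasPropertyT.exists_fixedPoint [IsTopologicalGroup G] (hT : HasPropertyT G)
    {H : Type*} [NormedAddCommGroup H] [InnerProductSpace ℂ H] [CompleteSpace H]
    (κ : G →* (H ≃ₗᵢ[ℂ] H)) (b : G → H) (hb : ∀ g h, b (g * h) = b g + κ g (b h))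
    (hbc : Continuous fun g => ‖b g‖) : ∃ v, ∀ g, κ g v + b g = v := by
  obtain ⟨M, hM⟩ := hT.exists_bound_of_cocycle κ b hb hbc
  exact exists_fixedPoint_of_bounded_cocycle κ b hb hM

/-- A square integrable function that is invariant up to a character is an invariant vector. -/
theorem koopmanHasAlmostInvariantVectors_of_withDensity_ne_top [SigmaFinite μ] (hμ0 : μ ≠ 0)
    (hpos : ∀ g, 0 < c g) (hc : ∀ g, μ.map (fun x => g • x) = ENNReal.ofReal (c g) • μ)
    (hκ : ∀ g (f : Lp ℂ 2 μ), κ g f =ᵐ[μ] fun x => (√(c g) : ℂ) * f (g⁻¹ • x))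
    [MeasurableConstSMul G X]
    {s : G →* ℝ} (hs : ∀ g, 0 < s g) {w : X → ℝ} (hw : Measurable w) (hw0 : ∀ x, 0 < w x)
    (hsw : ∀ g x, s g * √(c g) * w (g⁻¹ • x) = w x)
    (hfin : μ.withDensity (fun x => ENNReal.ofReal (w x ^ 2)) univ ≠ ∞) :
    KoopmanHasAlmostInvariantVectors μ (⊤ : Subgroup G) := by
  have hmem : MemLp (fun x => (w x : ℂ)) 2 μ := by
    refine ⟨(Complex.measurable_ofReal.comp hw).aestronglyMeasurable, ?_⟩
    rw [eLpNorm_lt_top_iff_lintegral_rpow_enorm_lt_top two_ne_zero ENNReal.ofNat_ne_top]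
    rw [withDensity_apply _ MeasurableSet.univ, Measure.restrict_univ] at hfin
    convert! lt_top_iff_ne_top.2 hfin using 2
    ext x
    rw [← ofReal_norm, Complex.norm_real, Real.norm_of_nonneg (hw0 x).le,
      ENNReal.ofReal_pow (hw0 x).le]
    simp
  let f := hmem.toLp _
  have hf : f =ᵐ[μ] fun x => (w x : ℂ) := MemLp.coeFn_toLp _
  have hf0 : f ≠ 0 := by
    intro h
    have : (ae μ).NeBot := ae_neBot.2 hμ0
    have h1 : f =ᵐ[μ] 0 := by rw [h]; exact Lp.coeFn_zero _ _ _
    obtain ⟨x, hx1, hx2⟩ := (h1.and hf).exists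
    rw [hx1] at hx2
    have := hw0 x
    have hx3 : (0 : ℂ) = w x := hx2
    exact this.ne (by exact_mod_cast hx3)
  have hinv : ∀ g, s g • κ g f = f := by
    intro g
    refine Lp.ext ?_
    filter_upwards [hκ g f, hf, (quasiMeasurePreserving_smul_of_map_eq hc g⁻¹).ae hf,
      Lp.coeFn_smul (s g) (κ g f)] with x h1 h2 h3 h4
    rw [h4, Pi.smul_apply, h1, h2, h3, ← hsw g x, Complex.real_smul]
    push_cast
    ring
  -- Since `κ g` is isometric, a nonzero vector fixed by `s g • κ g` forces `s g = 1`.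
  have hs1 : ∀ g, s g = 1 := by
    intro g
    have h1 := congrArg norm (hinv g)
    rw [norm_smul, LinearIsometryEquiv.norm_map, Real.norm_of_nonneg (hs g).le] at h1
    have := norm_pos_iff.2 hf0
    exact (mul_eq_right₀ this.ne').1 h1
  intro Q _ _ ε hε
  refine ⟨f, hf0, fun h _ => ?_⟩
  have h1 : koopman μ h f - ⇑f =ᵐ[μ] 0 := by
    have h2 := hinv h
    rw [hs1, one_smul] at h2
    filter_upwards [koopman_ae_eq hpos hc h f, hκ h f] with x h3 h4
    rw [Pi.sub_apply, h3, ← h4, h2, sub_self, Pi.zero_apply]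
  rw [eLpNorm_congr_ae h1, eLpNorm_zero]
  exact ENNReal.ofReal_pos.2 (mul_pos hε (norm_pos_iff.2 hf0))

end Coboundary

section InfiniteVolumeEnd

/-- The one-end theorem for the measure with density `w²`, where `w` is an invariant function up
to the positive character `s`. -/
theorem hasExactlyOneInfiniteVolumeEnd_withDensity {G X : Type*} [Group G] [TopologicalSpace G]
    [IsTopologicalGroup G] [T2Space G]
    [LocallyCompactSpace G] [SecondCountableTopology G] [PathConnectedSpace G]
    [TopologicalSpace X] [T2Space X] [LocallyCompactSpace X] [SecondCountableTopology X]
    [LocallyConnectedSpace X] [ConnectedSpace X]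
    [MulAction G X] [ContinuousSMul G X] [MulAction.IsPretransitive G X]
    [MeasurableSpace X] [BorelSpace X] {μ : Measure X} [IsLocallyFiniteMeasure μ]
    (hμ0 : μ ≠ 0) {c : G →* ℝ} (hpos : ∀ g, 0 < c g)
    (hc : ∀ g, μ.map (fun x => g • x) = ENNReal.ofReal (c g) • μ)
    (hnc : ¬ KoopmanHasAlmostInvariantVectors μ (⊤ : Subgroup G))
    (h : HasPropertyT G ∨ ∃ S : ℕ → Subgroup G, (⨆ n, S n) = ⊤ ∧
      (∀ n, ∀ g ∈ S n, ∀ h ∈ S (n + 1), g * h = h * g) ∧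
      (∀ n, ¬ KoopmanHasInvariantVector μ (S n)) ∧
      ∃ i, ¬ KoopmanHasAlmostInvariantVectors μ (S i))
    {s : G →* ℝ} (hs : ∀ g, 0 < s g) (hsT : HasPropertyT G → ∀ g, s g = 1)
    {w : X → ℝ} (hw : Continuous w) (hw0 : ∀ x, 0 < w x)
    (hsw : ∀ g x, s g * √(c g) * w (g⁻¹ • x) = w x) :
    HasExactlyOneInfiniteVolumeEnd (μ.withDensity fun x => ENNReal.ofReal (w x ^ 2)) := by
  have := IsLocallyFiniteMeasure.withDensity_ofReal (μ := μ) (hw.pow 2)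
  obtain ⟨κ, hκ⟩ := exists_koopman_rep (μ := μ) hpos hc
  refine hasExactlyOneInfiniteVolumeEnd_of_dichotomy _ ?_ fun D K hDm hK hD => ?_
  · by_contra hfin
    exact hnc (koopmanHasAlmostInvariantVectors_of_withDensity_ne_top hμ0 hpos hc hκ hs
      hw.measurable hw0 hsw hfin)
  · refine withDensity_lt_top_or_compl_lt_top hμ0 hc hκ hw hw0 hsw (fun b hb hbc => ?_) hDm hK hD
    rcases h with hT | ⟨S, hS, hcomm, hinv, i, hai⟩
    · have hs1 := hsT hT
      simp only [hs1, one_smul] at hb ⊢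
      exact hT.exists_fixedPoint κ b hb hbc
    · exact exists_fixedPoint_of_isGeneratedByCommutingChain hpos hc hκ hS hcomm hinv hai hs b hb hbc

end InfiniteVolumeEnd

/-! ### The invariant measure in the unimodular case -/

section OrbitMap

variable {G X : Type*} [Group G] [TopologicalSpace G] [IsTopologicalGroup G]
  [SecondCountableTopology G] [MulAction G X] [MeasurableSpace G] [BorelSpace G]

/-- Countably many right translates `U * h` cover `G`, and the orbit map of `x₀` on `U * h` is that
of `h • x₀` on `U`, hence injective. -/
theorem exists_measurable_partition_injOn_orbitMap {U : Set G} (hUo : IsOpen U) (h1U : (1 : G) ∈ U)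
    (hU : ∀ x : X, InjOn (fun g : G => g • x) U) (x₀ : X) :
    ∃ B V : ℕ → Set G, (∀ n, MeasurableSet (B n)) ∧ Pairwise (Function.onFun Disjoint B) ∧
      ⋃ n, B n = univ ∧ (∀ n, B n ⊆ V n) ∧ (∀ n, IsOpen (V n)) ∧
      ∀ n, InjOn (fun g : G => g • x₀) (V n) := by
  have hV : ∀ h : G, IsOpen ((fun z => z * h⁻¹) ⁻¹' U) := fun h =>
    hUo.preimage (continuous_mul_const _)
  obtain ⟨s, hsc, hs⟩ := TopologicalSpace.countable_cover_nhds
    (f := fun h : G => (fun z => z * h⁻¹) ⁻¹' U) fun h => (hV h).mem_nhds (by simpa using h1U)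
  have hsne : s.Nonempty := by
    by_contra h
    rw [not_nonempty_iff_eq_empty] at h
    have : (1 : G) ∈ (univ : Set G) := mem_univ _
    rw [← hs, h] at this
    simp at this
  obtain ⟨e, rfl⟩ := hsc.exists_eq_range hsne
  refine ⟨disjointed fun n => (fun z => z * (e n)⁻¹) ⁻¹' U, fun n => (fun z => z * (e n)⁻¹) ⁻¹' U,
    fun n => MeasurableSet.disjointed (fun n => (hV (e n)).measurableSet) n, disjoint_disjointed _,
    ?_, fun n => disjointed_subset _ n, fun n => hV (e n), fun n => ?_⟩
  · rw [iUnion_disjointed, ← hs, biUnion_range]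
  · intro z hz z' hz' h
    have := hU (e n • x₀) hz hz' (by simpa [smul_smul] using h)
    exact mul_right_cancel this

theorem measure_ext_of_injOn_orbitMap {U : Set G} (hUo : IsOpen U) (h1U : (1 : G) ∈ U)
    (hU : ∀ x : X, InjOn (fun g : G => g • x) U) (x₀ : X) {ν ν' : Measure G}
    (h : ∀ E, MeasurableSet E → InjOn (fun g : G => g • x₀) E → ν E = ν' E) : ν = ν' := by
  obtain ⟨B, V, hBm, hBd, hBu, hBV, hVo, hVi⟩ :=
    exists_measurable_partition_injOn_orbitMap hUo h1U hU x₀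
  ext E hE
  have hdec : ∀ ρ : Measure G, ρ E = ∑' n, ρ (E ∩ B n) := by
    intro ρ
    rw [← measure_iUnion, ← inter_iUnion, hBu, inter_univ]
    · exact fun n m hnm => (hBd hnm).mono inter_subset_right inter_subset_right
    · exact fun n => hE.inter (hBm n)
  rw [hdec ν, hdec ν']
  exact tsum_congr fun n => h _ (hE.inter (hBm n))
    ((hVi n).mono (inter_subset_right.trans (hBV n)))

variable [TopologicalSpace X] [T2Space X] [LocallyCompactSpace X] [LocallyCompactSpace G]
  [ContinuousSMul G X] [MulAction.IsPretransitive G X] [MeasurableSpace X] [BorelSpace X]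

theorem measurableSet_image_orbitMap {V E : Set G} (hV : IsOpen V) (x₀ : X)
    (hVi : InjOn (fun g : G => g • x₀) V) (hE : MeasurableSet E) (hEV : E ⊆ V) :
    MeasurableSet ((fun g : G => g • x₀) '' E) := by
  have hp : IsOpenMap (fun g : G => g • x₀) := isOpenMap_smul_of_sigmaCompact x₀
  have hemb : IsOpenEmbedding (fun g : V => (g : G) • x₀) :=
    .of_continuous_injective_isOpenMap (by fun_prop) (injOn_iff_injective.1 hVi)
      (hp.comp hV.isOpenMap_subtype_val)
  have h1 := hemb.measurableEmbedding.measurableSet_image.2 (measurable_subtype_coe hE)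
  convert h1 using 1
  ext y
  constructor
  · rintro ⟨g, hg, rfl⟩
    exact ⟨⟨g, hEV hg⟩, hg, rfl⟩
  · rintro ⟨g, hg, rfl⟩
    exact ⟨g, hg, rfl⟩

/-- The pullback of a measure under an orbit map with discrete stabilizer. -/
theorem exists_pullback_orbitMap {U : Set G} (hUo : IsOpen U) (h1U : (1 : G) ∈ U)
    (hU : ∀ x : X, InjOn (fun g : G => g • x) U) (x₀ : X) (μ : Measure X) :
    ∃ ν : Measure G, ∀ E, MeasurableSet E → InjOn (fun g : G => g • x₀) E →
      ν E = μ ((fun g : G => g • x₀) '' E) := by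
  have hp : IsOpenMap (fun g : G => g • x₀) := isOpenMap_smul_of_sigmaCompact x₀
  obtain ⟨B, V, hBm, hBd, hBu, hBV, hVo, hVi⟩ :=
    exists_measurable_partition_injOn_orbitMap hUo h1U hU x₀
  have hemb : ∀ n, IsOpenEmbedding (fun g : V n => (g : G) • x₀) := fun n =>
    .of_continuous_injective_isOpenMap (by fun_prop) (injOn_iff_injective.1 (hVi n))
      (hp.comp (hVo n).isOpenMap_subtype_val)
  refine ⟨Measure.sum fun n =>
    ((μ.comap (fun g : V n => (g : G) • x₀)).map (↑)).restrict (B n), fun E hE hEi => ?_⟩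
  have hterm : ∀ n, ((μ.comap (fun g : V n => (g : G) • x₀)).map (↑)).restrict (B n) E =
      μ ((fun g : G => g • x₀) '' (E ∩ B n)) := by
    intro n
    rw [Measure.restrict_apply hE, Measure.map_apply measurable_subtype_coe (hE.inter (hBm n)),
      (hemb n).measurableEmbedding.comap_apply]
    congr 1
    ext y
    constructor
    · rintro ⟨g, hg, rfl⟩
      exact ⟨g, hg, rfl⟩
    · rintro ⟨g, hg, rfl⟩
      exact ⟨⟨g, hBV n hg.2⟩, hg, rfl⟩
  rw [Measure.sum_apply _ hE]
  simp_rw [hterm]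
  rw [← measure_iUnion, ← image_iUnion, ← inter_iUnion, hBu, inter_univ]
  · intro n m hnm
    rw [Function.onFun, disjoint_left]
    rintro _ ⟨a, ha, rfl⟩ ⟨b, hb, hab⟩
    rw [hEi hb.1 ha.1 hab] at hb
    exact disjoint_left.1 (hBd hnm) ha.2 hb.2
  · exact fun n => measurableSet_image_orbitMap (hVo n) x₀ (hVi n) (hE.inter (hBm n))
      (inter_subset_right.trans (hBV n))

/-- On a homogeneous space with discrete stabilizers of a unimodular group, a relatively invariant
measure has an invariant density, which gives translates of a small set a constant mass. -/
theorem exists_invariant_density [T2Space G] [SecondCountableTopology X]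
    (hG : IsUnimodularGroup G) {U : Set G} (hUo : IsOpen U) (h1U : (1 : G) ∈ U)
    (hU : ∀ x : X, InjOn (fun g : G => g • x) U) {μ : Measure X} [IsLocallyFiniteMeasure μ]
    (hμ0 : μ ≠ 0) {c : G →* ℝ} (hpos : ∀ g, 0 < c g)
    (hc : ∀ g, μ.map (fun x => g • x) = ENNReal.ofReal (c g) • μ) (x₀ : X) :
    ∃ w : X → ℝ, Continuous w ∧ (∀ x, 0 < w x) ∧ (∀ g x, √(c g) * w (g⁻¹ • x) = w x) ∧
      ∀ A ⊆ U, A ∈ 𝓝 (1 : G) → MeasurableSet A → ∃ δ : ℝ≥0∞, δ ≠ 0 ∧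
        ∀ x : X, μ.withDensity (fun y => ENNReal.ofReal (w y ^ 2)) ((fun g : G => g • x) '' A) = δ := by
  have hp : IsOpenMap (fun g : G => g • x₀) := isOpenMap_smul_of_sigmaCompact x₀
  have hcc : Continuous c := continuous_character_of_map_smul_eq hμ0 hpos hc
  obtain ⟨ν, hν⟩ := exists_pullback_orbitMap hUo h1U hU x₀ μ
  have hνleft : ∀ g : G, ν.map (fun h => g * h) = ENNReal.ofReal (c g) • ν := by
    intro g
    refine measure_ext_of_injOn_orbitMap hUo h1U hU x₀ fun E hE hEi => ?_
    have hi : InjOn (fun g : G => g • x₀) ((fun h => g * h) ⁻¹' E) := by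
      intro a ha b hb hab
      refine mul_left_cancel (hEi ha hb ?_)
      simpa [mul_smul] using hab
    have him : (fun g : G => g • x₀) '' ((fun h => g * h) ⁻¹' E) =
        (fun x => g • x) ⁻¹' ((fun g : G => g • x₀) '' E) := by
      ext y
      constructor
      · rintro ⟨h, hh, rfl⟩
        exact ⟨g * h, hh, mul_smul _ _ _⟩
      · rintro ⟨h, hh, hy⟩
        refine ⟨g⁻¹ * h, by simpa using hh, ?_⟩
        simp only at hy
        simp [mul_smul, hy]
    rw [Measure.map_apply (measurable_const_mul g) hE, hν _ (measurable_const_mul g hE) hi, him,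
      Measure.smul_apply, hν E hE hEi, ← Measure.smul_apply, ← hc g]
    exact ((MeasurableEquiv.smul g).map_apply _).symm
  have hνright : ∀ γ : G, γ • x₀ = x₀ → ν.map (fun h => h * γ) = ν := by
    intro γ hγ
    refine measure_ext_of_injOn_orbitMap hUo h1U hU x₀ fun E hE hEi => ?_
    have hi : InjOn (fun g : G => g • x₀) ((fun h => h * γ) ⁻¹' E) := by
      intro a ha b hb hab
      refine mul_right_cancel (hEi ha hb ?_)
      simpa [mul_smul, hγ] using hab
    have him : (fun g : G => g • x₀) '' ((fun h => h * γ) ⁻¹' E) =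
        (fun g : G => g • x₀) '' E := by
      ext y
      constructor
      · rintro ⟨h, hh, rfl⟩
        exact ⟨h * γ, hh, by simp [mul_smul, hγ]⟩
      · rintro ⟨h, hh, rfl⟩
        have hγ' : γ⁻¹ • x₀ = x₀ := by rw [inv_smul_eq_iff, hγ]
        exact ⟨h * γ⁻¹, by simpa using hh, by simp [mul_smul, hγ']⟩
    rw [Measure.map_apply (measurable_mul_const γ) hE, hν _ (measurable_mul_const γ hE) hi, him,
      hν E hE hEi]
  -- The weight `c` cancels the factor in `hνleft`, so `lam` is a Haar measure, and by unimodularity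
  -- it is also right invariant.
  let lam : Measure G := ν.withDensity fun h => ENNReal.ofReal (c h)
  have hcm : Measurable fun h => ENNReal.ofReal (c h) := by fun_prop
  have hcmul : ∀ g h, ENNReal.ofReal (c (g * h)) = ENNReal.ofReal (c g) * ENNReal.ofReal (c h) :=
    fun g h => by rw [map_mul, ENNReal.ofReal_mul (hpos g).le]
  have hc0 : ∀ g, ENNReal.ofReal (c g) ≠ 0 := fun g => (ENNReal.ofReal_pos.2 (hpos g)).ne'
  have hlamleft : lam.IsMulLeftInvariant := by
    refine ⟨fun g => ?_⟩
    ext E hE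
    rw [Measure.map_apply (measurable_const_mul g) hE,
      withDensity_apply _ (measurable_const_mul g hE), withDensity_apply _ hE]
    have h1 := setLIntegral_map hE hcm (measurable_const_mul g) (μ := ν)
    rw [hνleft, Measure.restrict_smul, lintegral_smul_measure] at h1
    simp only [hcmul] at h1
    rw [lintegral_const_mul _ hcm, smul_eq_mul] at h1
    exact ((ENNReal.mul_right_inj (hc0 g) ENNReal.ofReal_ne_top).1 h1).symm
  obtain ⟨K, hKn, hKU, hK⟩ := local_compact_nhds (hUo.mem_nhds h1U)
  have hνK : ν K = μ ((fun g : G => g • x₀) '' K) := hν K hK.measurableSet ((hU x₀).mono hKU)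
  have hνKtop : ν K ≠ ∞ := by
    rw [hνK]
    exact (hK.image (by fun_prop)).measure_lt_top.ne
  have hνK0 : ν K ≠ 0 := by
    intro h0
    rw [hνK] at h0
    set O := (fun g : G => g • x₀) '' K with hO
    have hOn : O ∈ 𝓝 x₀ := by
      have := hp.image_mem_nhds hKn
      simpa using this
    apply hμ0
    rw [← Measure.measure_univ_eq_zero]
    refine measure_null_of_locally_null _ fun x _ => ?_
    obtain ⟨g, rfl⟩ := MulAction.exists_smul_eq G x₀ x
    refine ⟨(fun x => g⁻¹ • x) ⁻¹' O, mem_nhdsWithin_of_mem_nhds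
      ((continuous_const_smul g⁻¹).continuousAt.preimage_mem_nhds (by simpa using hOn)), ?_⟩
    have h1 : μ.map (fun x => g⁻¹ • x) O = μ ((fun x => g⁻¹ • x) ⁻¹' O) :=
      (MeasurableEquiv.smul g⁻¹).map_apply _
    rw [← h1, hc, Measure.smul_apply, h0, smul_zero]
  have hlamK : lam K ≠ 0 := by
    intro h0
    have := (withDensity_apply_eq_zero hcm).1 h0
    have h1 : {x | ENNReal.ofReal (c x) ≠ 0} ∩ K = K :=
      inter_eq_right.2 fun x _ => hc0 x
    rw [h1] at this
    exact hνK0 this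
  have hlamKtop : lam K ≠ ∞ := by
    obtain ⟨M, hM⟩ := (hK.image hcc).bddAbove
    rw [withDensity_apply _ hK.measurableSet]
    have h1 : ∫⁻ h in K, ENNReal.ofReal (c h) ∂ν ≤ ∫⁻ _ in K, ENNReal.ofReal M ∂ν :=
      setLIntegral_mono measurable_const fun h hh => ENNReal.ofReal_le_ofReal (hM ⟨h, hh, rfl⟩)
    rw [setLIntegral_const] at h1
    exact (h1.trans_lt (ENNReal.mul_lt_top ENNReal.ofReal_lt_top hνKtop.lt_top)).ne
  have hhaar : lam.IsHaarMeasure :=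
    Measure.isHaarMeasure_of_isCompact_nonempty_interior lam K hK
      ⟨1, mem_interior_iff_mem_nhds.2 hKn⟩ hlamK hlamKtop
  have hlamright : ∀ g : G, lam.map (fun h => h * g) = lam := by
    intro g
    have := Measure.map_right_mul_eq_modularCharacterFun_smul lam g
    have h1 : Measure.modularCharacterFun g = 1 := hG g
    rw [this, h1, one_smul]
  -- Under the stabilizer of `x₀` both `ν` and `lam = c ν` are right invariant, so `c` is trivial
  -- there and descends to `X`.
  have hcγ : ∀ γ : G, γ • x₀ = x₀ → c γ = 1 := by
    intro γ hγ
    have h1 := setLIntegral_map hK.measurableSet hcm (measurable_mul_const γ) (μ := ν)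
    rw [hνright γ hγ] at h1
    simp only [hcmul, mul_comm _ (ENNReal.ofReal (c γ))] at h1
    rw [lintegral_const_mul _ hcm, ← withDensity_apply _ hK.measurableSet,
      ← withDensity_apply _ (measurable_mul_const γ hK.measurableSet),
      ← Measure.map_apply (measurable_mul_const γ) hK.measurableSet] at h1
    change lam K = _ * lam.map (fun h => h * γ) K at h1
    rw [hlamright] at h1
    have h2 : ENNReal.ofReal (c γ) = 1 := by
      rw [← ENNReal.mul_left_inj hlamK hlamKtop, one_mul, ← h1]
    exact ENNReal.ofReal_eq_one.1 h2
  choose r hr using fun x : X => MulAction.exists_smul_eq G x₀ x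
  let w : X → ℝ := fun x => √(c (r x))
  have hw : ∀ g : G, w (g • x₀) = √(c g) := by
    intro g
    have h1 : (g⁻¹ * r (g • x₀)) • x₀ = x₀ := by
      rw [mul_smul, hr, inv_smul_smul]
    have h2 := hcγ _ h1
    have h3 : c (r (g • x₀)) = c g := by
      rw [← mul_inv_cancel_left g (r (g • x₀)), map_mul, h2, mul_one]
    simp only [w, h3]
  have hwc : Continuous w := by
    have hquot : IsQuotientMap (fun g : G => g • x₀) :=
      hp.isQuotientMap (by fun_prop) (MulAction.surjective_smul G x₀)
    rw [hquot.continuous_iff]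
    have : w ∘ (fun g : G => g • x₀) = fun g => √(c g) := funext hw
    rw [this]
    exact hcc.sqrt
  refine ⟨w, hwc, fun x => Real.sqrt_pos.2 (hpos _), fun g x => ?_, fun A hAU hA hAm => ?_⟩
  · obtain ⟨h, rfl⟩ := MulAction.exists_smul_eq G x₀ x
    rw [← mul_smul, hw, hw, ← Real.sqrt_mul (hpos g).le, ← map_mul, mul_inv_cancel_left]
  · refine ⟨lam A, (Measure.measure_pos_of_mem_nhds lam hA).ne', fun x => ?_⟩
    obtain ⟨g, rfl⟩ := MulAction.exists_smul_eq G x₀ x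
    set p : G → X := fun g : G => g • x₀ with hpdef
    have hpm : Measurable p := by
      have : Continuous p := by fun_prop
      exact this.measurable
    set V : Set G := (fun h => h * g⁻¹) ⁻¹' U with hV
    set E : Set G := (fun h => h * g⁻¹) ⁻¹' A with hE
    have hEV : E ⊆ V := preimage_mono hAU
    have hVo : IsOpen V := hUo.preimage (continuous_mul_const _)
    have hEm : MeasurableSet E := measurable_mul_const _ hAm
    have hVi : InjOn p V := by
      intro a ha b hb hab
      refine mul_right_cancel (hU (g • x₀) ha hb ?_)
      simpa [smul_smul] using hab
    have him : (fun h : G => h • g • x₀) '' A = p '' E := by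
      ext y
      constructor
      · rintro ⟨h, hh, rfl⟩
        exact ⟨h * g, by simpa [hE] using hh, mul_smul _ _ _⟩
      · rintro ⟨h, hh, rfl⟩
        exact ⟨h * g⁻¹, hh, by simp [p, smul_smul]⟩
    have hpE : MeasurableSet (p '' E) := measurableSet_image_orbitMap hVo x₀ hVi hEm hEV
    -- The orbit map carries `ν` on `E` to `μ` on `p '' E`. As `w ^ 2` pulls back to `c`, the mass
    -- is `lam E`, which equals `lam A` by right invariance.
    have hmap : (ν.restrict E).map p = μ.restrict (p '' E) := by
      ext S hS
      rw [Measure.map_apply hpm hS, Measure.restrict_apply (hpm hS), Measure.restrict_apply hS,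
        hν _ ((hpm hS).inter hEm) (hVi.mono (inter_subset_right.trans hEV))]
      congr 1
      rw [inter_comm, inter_comm S]
      exact image_inter_preimage p E S
    have hwm : Measurable fun y => ENNReal.ofReal (w y ^ 2) :=
      (hwc.pow 2).measurable.ennreal_ofReal
    rw [him, withDensity_apply _ hpE, ← hmap, lintegral_map hwm hpm]
    have h2 : ∀ h, ENNReal.ofReal (w (p h) ^ 2) = ENNReal.ofReal (c h) := fun h => by
      rw [hpdef, hw, Real.sq_sqrt (hpos h).le]
    simp only [h2]
    rw [← withDensity_apply _ hEm, hE, ← Measure.map_apply (measurable_mul_const _) hAm]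
    change lam.map (fun h => h * g⁻¹) A = lam A
    rw [hlamright]

end OrbitMap

/-! ### From infinite volume ends to topological ends -/

section Ends

/-- The infinite components are nested by uniqueness. No member of an end is relatively compact: a
compact set lies in some `K m`, which later members avoid. -/
theorem hasExactlyOneEnd_of_hasExactlyOneInfiniteVolumeEnd {X : Type*} [TopologicalSpace X]
    [T2Space X] [LocallyConnectedSpace X] [MeasurableSpace X] {ν : Measure X}
    (hone : HasExactlyOneInfiniteVolumeEnd ν)
    (hinf : ∀ K C : Set X, IsCompact K → IsComponentOf C Kᶜ → (∀ L, IsCompact L → ¬ C ⊆ L) →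
      ν C = ∞) : HasExactlyOneEnd X := by
  intro K hK
  choose C hC hCu using fun n => hone (K n) (hK.isCompact n)
  have hsub : ∀ n, C (n + 1) ⊆ C n := by
    intro n
    obtain ⟨x, hx⟩ := (hC (n + 1)).1.nonempty
    have hKn : (K (n + 1))ᶜ ⊆ (K n)ᶜ := compl_subset_compl.2 (hK.mono n.le_succ)
    have hxK : x ∈ (K n)ᶜ := hKn ((hC (n + 1)).1.subset hx)
    have h1 : C (n + 1) ⊆ connectedComponentIn (K n)ᶜ x :=
      (hC (n + 1)).1.isPreconnected.subset_connectedComponentIn hx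
        ((hC (n + 1)).1.subset.trans hKn)
    have h2 : ν (connectedComponentIn (K n)ᶜ x) = ∞ :=
      top_le_iff.1 ((hC (n + 1)).2.symm.le.trans (measure_mono h1))
    rwa [hCu n _ ⟨⟨x, hxK, rfl⟩, h2⟩] at h1
  refine ⟨C, fun n => ⟨(hC n).1.isOpen (hK.isCompact n).isClosed.isOpen_compl, (hC n).1, hsub n⟩,
    fun U hU => funext fun n => hCu n _ ⟨(hU n).2.1, hinf _ _ (hK.isCompact n) (hU n).2.1 ?_⟩⟩
  intro L hL hUL
  have hanti : Antitone U := antitone_nat_of_succ_le fun n => (hU n).2.2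
  obtain ⟨m, hm⟩ := hL.elim_directed_cover (fun n => interior (K n)) (fun n => isOpen_interior)
    (by rw [hK.cover]; exact subset_univ L)
    (directed_of_isDirected_le fun a b hab => interior_mono (hK.mono hab))
  obtain ⟨x, hx⟩ := (hU (max m n)).2.1.nonempty
  exact (hU (max m n)).2.1.subset hx
    (hK.mono (le_max_left m n) (interior_subset (hm (hUL (hanti (le_max_right m n) hx)))))

/-- A component of the complement of a compact set that is not relatively compact contains
infinitely many disjoint translates of a small connected set, hence has infinite measure. -/
theorem IsComponentOf.measure_eq_top_of_not_subset_compact {G X : Type*} [Group G]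
    [TopologicalSpace G] [IsTopologicalGroup G] [TopologicalSpace X] [T2Space X] [MulAction G X]
    [ContinuousSMul G X] [MeasurableSpace X] [BorelSpace X] {ν : Measure X} {V : Set G}
    (hVc : IsCompact V) (hVp : IsPreconnected V) (h1V : (1 : G) ∈ V) {δ : ℝ≥0∞} (hδ : δ ≠ 0)
    (hν : ∀ x : X, ν ((fun g : G => g • x) '' V) = δ)
    {K C : Set X} (hK : IsCompact K) (hC : IsComponentOf C Kᶜ)
    (hnc : ∀ L, IsCompact L → ¬ C ⊆ L) : ν C = ∞ := by
  -- Avoiding `V⁻¹ • K` keeps the translate of `V` at `x` off `K`, hence inside `C`. Avoiding `V⁻¹ •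
  -- V • {y}` makes it disjoint from the one at `y`.
  obtain ⟨x, hxP, hxr⟩ := exists_seq_of_forall_finset_exists
    (fun x : X => x ∈ C ∧ x ∉ V⁻¹ • K) (fun y x => x ∉ V⁻¹ • V • ({y} : Set X)) (by
    intro s _
    have hcomp : IsCompact (V⁻¹ • K ∪ ⋃ y ∈ s, V⁻¹ • V • ({y} : Set X)) :=
      (hVc.inv.smul_set hK).union
        (s.isCompact_biUnion fun y _ => hVc.inv.smul_set (hVc.smul_set isCompact_singleton))
    obtain ⟨x, hxC, hx⟩ := not_subset.1 (hnc _ hcomp)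
    rw [mem_union, not_or] at hx
    exact ⟨x, ⟨hxC, hx.1⟩, fun y hy hxy => hx.2 (mem_iUnion₂.2 ⟨y, hy, hxy⟩)⟩)
  have hsub : ∀ n, (fun g : G => g • x n) '' V ⊆ C := by
    intro n
    have hpre : IsPreconnected ((fun g : G => g • x n) '' V) := hVp.image _ (by fun_prop)
    rw [hC.eq_connectedComponentIn (hxP n).1]
    refine hpre.subset_connectedComponentIn ⟨1, h1V, one_smul _ _⟩ ?_
    rintro _ ⟨g, hg, rfl⟩ hgK
    exact (hxP n).2 ⟨g⁻¹, inv_mem_inv.2 hg, _, hgK, inv_smul_smul _ _⟩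
  have hdisj' : ∀ m n, m < n →
      Disjoint ((fun g : G => g • x m) '' V) ((fun g : G => g • x n) '' V) := by
    intro m n hmn
    rw [disjoint_left]
    rintro _ ⟨g, hg, rfl⟩ ⟨h, hh, hgh⟩
    refine hxr m n hmn ⟨h⁻¹, inv_mem_inv.2 hh, g • x m, ⟨g, hg, x m, rfl, rfl⟩, ?_⟩
    simp only at hgh
    simp only
    rw [← hgh, inv_smul_smul]
  have hdisj : Pairwise (Function.onFun Disjoint fun n => (fun g : G => g • x n) '' V) := by
    intro m n hmn
    rcases lt_or_gt_of_ne hmn with h | h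
    · exact hdisj' m n h
    · exact (hdisj' n m h).symm
  rw [eq_top_iff]
  calc ∞ = ∑' n, ν ((fun g : G => g • x n) '' V) := by
        simp only [hν]
        exact (ENNReal.tsum_const_eq_top_of_ne_zero hδ).symm
    _ = ν (⋃ n, (fun g : G => g • x n) '' V) :=
        (measure_iUnion hdisj fun n => (hVc.image (by fun_prop)).measurableSet).symm
    _ ≤ ν C := measure_mono (iUnion_subset hsub)

end Ends

/-! ### The main theorem -/

theorem QuotientGroup.t2Space_of_isClosed {G : Type*} [Group G] [TopologicalSpace G]
    [IsTopologicalGroup G] (Γ : Subgroup G) (hΓ : IsClosed (Γ : Set G)) : T2Space (G ⧸ Γ) := by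
  rw [t2Space_iff_of_isOpenQuotientMap QuotientGroup.isOpenQuotientMap_mk]
  have : {q : G × G | (QuotientGroup.mk q.1 : G ⧸ Γ) = QuotientGroup.mk q.2} =
      (fun q : G × G => q.1⁻¹ * q.2) ⁻¹' Γ := by
    ext q
    simp [QuotientGroup.eq]
  rw [this]
  exact hΓ.preimage (by fun_prop)

theorem theorem1p1 {G : Type*} [Group G] [TopologicalSpace G] [IsTopologicalGroup G] [T2Space G]
    [LocallyCompactSpace G] [SecondCountableTopology G] [PathConnectedSpace G]
    (Γ : Subgroup G) [DiscreteTopology Γ]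
    [MeasurableSpace (G ⧸ Γ)] [BorelSpace (G ⧸ Γ)]
    (μ : Measure (G ⧸ Γ)) [μ.Regular] (hμ0 : μ ≠ 0) (hμ : IsRelativelyInvariant G μ)
    (hΓ : ¬ IsCoamenable Γ μ)
    (h : HasPropertyT G ∨ IsGeneratedByCommutingChain Γ μ) :
    HasExactlyOneInfiniteVolumeEnd μ ∧
      (IsUnimodularGroup G → InjectivityRadiusBoundedBelow Γ → HasExactlyOneEnd (G ⧸ Γ)) := by
  have : T2Space (G ⧸ Γ) := QuotientGroup.t2Space_of_isClosed Γ Subgroup.isClosed_of_discrete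
  have : LocallyConnectedSpace G := .of_pathConnected_group
  have : LocallyConnectedSpace (G ⧸ Γ) :=
    QuotientGroup.isOpenQuotientMap_mk.locallyConnectedSpace
  have : ConnectedSpace (G ⧸ Γ) :=
    Quotient.mk_surjective.connectedSpace QuotientGroup.continuous_mk
  obtain ⟨c, hpos, hc⟩ := hμ.exists_character hμ0
  have hcT : HasPropertyT G → ∀ g, c g = 1 := fun hT g =>
    hT.character_eq_one hpos (continuous_character_of_map_smul_eq hμ0 hpos hc) g
  refine ⟨?_, fun hG ⟨U₀, hU₀, _, hU₀i⟩ => ?_⟩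
  -- With `s = c^(-1/2)` the constant `w = 1` is admissible, so the measure in question is `μ`
  -- itself.
  · let s : G →* ℝ :=
      { toFun := fun g => (√(c g))⁻¹
        map_one' := by simp
        map_mul' := fun g h => by rw [map_mul, Real.sqrt_mul (hpos g).le, mul_inv] }
    have hs : ∀ g, s g = (√(c g))⁻¹ := fun _ => rfl
    have key := hasExactlyOneInfiniteVolumeEnd_withDensity hμ0 hpos hc hΓ h (s := s)
      (fun g => inv_pos.2 (Real.sqrt_pos.2 (hpos g))) (fun hT g => by simp [hs, hcT hT g])
      (w := fun _ => 1) continuous_const (fun _ => one_pos) (fun g x => by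
        rw [hs, inv_mul_cancel₀ (Real.sqrt_pos.2 (hpos g)).ne', one_mul])
    have h1 : μ.withDensity (fun _ => ENNReal.ofReal ((1 : ℝ) ^ 2)) = μ := by
      simp
    rwa [h1] at key
  · borelize G
    obtain ⟨U, hUU₀, hUo, h1U⟩ := mem_nhds_iff.1 hU₀
    have hU : ∀ x : G ⧸ Γ, InjOn (fun g : G => g • x) U := fun x => (hU₀i x).mono hUU₀
    obtain ⟨w, hw, hw0, hsw, hmass⟩ :=
      exists_invariant_density hG hUo h1U hU hμ0 hpos hc (QuotientGroup.mk 1)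
    obtain ⟨N, hN, hNU, hNc⟩ := local_compact_nhds (hUo.mem_nhds h1U)
    have hVn := connectedComponentIn_mem_nhds hN
    have hVc : IsCompact (connectedComponentIn N 1) := hNc.of_isClosed_subset
      (hNc.isClosed.isClosed_connectedComponentIn 1) (connectedComponentIn_subset N 1)
    obtain ⟨δ, hδ, hδmass⟩ := hmass _ ((connectedComponentIn_subset N 1).trans hNU) hVn
      hVc.measurableSet
    -- Here `s = 1`, and the end theorem is applied to the invariant measure `w² μ` rather than to
    -- `μ`.
    have key := hasExactlyOneInfiniteVolumeEnd_withDensity hμ0 hpos hc hΓ h (s := 1)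
      (fun _ => one_pos) (fun _ _ => rfl) hw hw0 (fun g x => by
        rw [MonoidHom.one_apply, one_mul, hsw])
    exact hasExactlyOneEnd_of_hasExactlyOneInfiniteVolumeEnd key fun K C hK hC hnc =>
      hC.measure_eq_top_of_not_subset_compact hVc isPreconnected_connectedComponentIn
        (mem_of_mem_nhds hVn) hδ hδmass hK hnc
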